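/- Let $T$ be a finite abelian group with unit $e_T$, and let $\mathfrak S_n(T)=T^n\rtimes\mathfrak S_n$. For $x\in T$ let $(x,(i))\in T^{n}$ have $i$-th entry $x$ and all other entries $e_T$. Let $$J_{n+1}=\sum_{i=1}^n\sum_{x\in T}(x^{-1},(i))\,(x,(n+1))\,(i\ \,n{+}1)\in\mathbb C[\mathfrak S_{n+1}(T)],$$ and let $\mathrm E:\mathbb C[\mathfrak S_{n+1}(T)]\to\mathbb C[\mathfrak S_n(T)]$ be the linear map fixing the elements of $\mathfrak S_n(T)$ and sending those of $\mathfrak S_{n+1}(T)\setminus\mathfrak S_n(T)$ to $0$, where $\mathfrak S_n(T)\subset\mathfrak S_{n+1}(T)$ in the natural way (last letter fixed, last entry $e_T$). The type of $g=(t,\tau)\in\mathfrak S_n(T)$ is the family $(\rho_x)_{x\in T}$ of Young diagrams, where the rows of $\rho_x$ are the lengths of the cycles of $\tau$ (fixed points included) along which the entries of $t$ have product $x$. For a family $\rho=(\rho_x)_{x\in T}$ with total size $n$, $C_\rho$ is the conjugacy class of the elements of type $\rho$, and $A_{C_\rho}=\sum_{g\in C_\rho}g$. For a family $\rho$ of total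 size $m\le n$, $\iota_{n}\rho$ is obtained by adding $n-m$ rows of length $1$ to the $e_T$-entry of $\rho$. For $k\ge 0$ let $\overline{\mathbb Y}_k$ be the set of Young diagrams of size $k$ without rows of length $1$. For $\sigma\in\overline{\mathbb Y}_k$ let $l(\sigma)$ be the number of rows, $\sigma^\times$ the diagram obtained by removing the first column, $m_i(\sigma^\times)$ the number of its rows of length $i$, and $\mathrm{NC}(\sigma)$ the set of non-crossing partitions of $\{1,\dots,k\}$ whose block sizes are the rows of $\sigma$. Let $k\ge0$ and $y\in T$. Then $\mathrm E[J_{n+1}^k\,(y,(n+1))]$ belongs to the center of $\mathbb C[\mathfrak S_n(T)]$ for every $n$. Moreover there are, for $\sigma\in\overline{\mathbb Y}_k$, real numbers $\varepsilon_\sigma(n)=O(n^{-1})$ and finite multisets $N_\sigma=N_\sigma^{(n)}$ of elements of $\mathfrak S_n(T)$ such that for all sufficiently large $n$ $$\mathrm E[J_{n+1}^{k}(y,(n+1))]=\sum_{\sigma\in\overline{\mathbb Y}_k}\Bigl\{\sum_{(n_i^x)}|\mathrm{NC}(\sigma)|\,n^{k-l(\sigma)}\bigl(1+\varepsilon_\sigma(n)\bigr)|T|^{k-l(\sigma)}\prod_{i\ge1}\frac{m_i(\sigma^\times)!}{\prod_{x\in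 T}n_i^x!}\ \frac{A_{C_{\iota_n\rho}}}{|C_{\iota_n\rho}|}+\sum_{g\in N_\sigma}g\Bigr\}.$$ Here the inner sum runs over the families of integers $n_i^x\ge0$ $(x\in T,\ i\ge1)$ with $\sum_{x\in T}n_i^x=m_i(\sigma^\times)$ for all $i$ and $\prod_{x\in T}x^{n_1^x+n_2^x+\cdots}=y$, and $\rho=((1^{n_1^x}2^{n_2^x}\cdots))_{x\in T}$. Call a cycle of $g=(t,\tau)$ nontrivial unless it is a fixed point of $\tau$ at which $t$ has the entry $e_T$. The multisets $N_\sigma$ satisfy, for every $\sigma\in\overline{\mathbb Y}_k$: (a) for each $g\in N_\sigma$, the lengths of the nontrivial cycles of $g$ are the rows of $\sigma^\times$ with possibly some rows of length $1$ omitted; (b) $|N_\sigma|=O(n^{k-l(\sigma)-1})$ as $n\to\infty$, where $|N_\sigma|$ counts elements with multiplicity. All implied constants may depend on $T,k,y,\sigma$ but not on $n$. -/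

import Mathlib

open Filter Asymptotics

namespace WreathJM

/-- The wreath product `𝔖_n(T) = T^n ⋊ 𝔖_n`; the symmetric group permutes the coordinates,
`(τ • t) i = t (τ⁻¹ i)`. -/
abbrev Wreath (T : Type*) [Group T] (n : ℕ) : Type _ :=
  (Fin n → T) ⋊[(mulAutArrow : Equiv.Perm (Fin n) →* MulAut (Fin n → T))] Equiv.Perm (Fin n)

instance instFintypeWreath (T : Type*) [Group T] [Fintype T] (n : ℕ) : Fintype (Wreath T n) :=
  Fintype.ofEquiv _ SemidirectProduct.equivProd.symm

/-- The group algebra `ℂ[𝔖_n(T)]`. -/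
abbrev GroupAlg (T : Type*) [Group T] (n : ℕ) : Type _ := MonoidAlgebra ℂ (Wreath T n)

/-- The element `(x, (i))` of `T^n ⊆ 𝔖_n(T)`: its `i`th entry is `x`, the others are `1`. -/
def atPos {T : Type*} [Group T] {n : ℕ} (x : T) (i : Fin n) : Wreath T n :=
  SemidirectProduct.inl (Pi.mulSingle i x)

/-- The transposition `(i j)` as an element of `𝔖_n(T)`. -/
def transp (T : Type*) [Group T] {n : ℕ} (i j : Fin n) : Wreath T n :=
  SemidirectProduct.inr (Equiv.swap i j)

/-- The Jucys--Murphy element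
`J_{n+1} = ∑_{i=1}^n ∑_{x ∈ T} (x⁻¹, (i)) (x, (n+1)) (i n+1)` of `ℂ[𝔖_{n+1}(T)]`. -/
noncomputable def jm (T : Type*) [Group T] [Fintype T] (n : ℕ) : GroupAlg T (n + 1) :=
  ∑ i : Fin n, ∑ x : T, MonoidAlgebra.of ℂ (Wreath T (n + 1))
    (atPos x⁻¹ i.castSucc * atPos x (Fin.last n) * transp T i.castSucc (Fin.last n))

/-- The inclusion `T^n ≅ T^n × {1} ⊆ T^{n+1}`. -/
def extendTuple (T : Type*) [Group T] (n : ℕ) : (Fin n → T) →* (Fin (n + 1) → T) where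
  toFun t := Fin.snoc (α := fun _ => T) t 1
  map_one' := by
    funext i
    refine Fin.lastCases ?_ (fun j => ?_) i <;> simp
  map_mul' s t := by
    funext i
    refine Fin.lastCases ?_ (fun j => ?_) i <;> simp

/-- The inclusion `𝔖_n ⊆ 𝔖_{n+1}` as the stabilizer of the last letter. -/
noncomputable def extendPerm (n : ℕ) : Equiv.Perm (Fin n) →* Equiv.Perm (Fin (n + 1)) :=
  Equiv.Perm.viaEmbeddingHom Fin.castSuccEmb

theorem extendPerm_castSucc {n : ℕ} (τ : Equiv.Perm (Fin n)) (i : Fin n) :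
    extendPerm n τ i.castSucc = (τ i).castSucc :=
  Equiv.Perm.viaEmbedding_apply τ Fin.castSuccEmb i

theorem extendPerm_last {n : ℕ} (τ : Equiv.Perm (Fin n)) :
    extendPerm n τ (Fin.last n) = Fin.last n := by
  refine Equiv.Perm.viaEmbedding_apply_of_notMem τ Fin.castSuccEmb _ ?_
  rintro ⟨i, hi⟩
  exact (Fin.castSucc_lt_last i).ne hi

/-- The inclusion `𝔖_n(T) ⊆ 𝔖_{n+1}(T)`. -/
noncomputable def incl (T : Type*) [Group T] (n : ℕ) : Wreath T n →* Wreath T (n + 1) :=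
  SemidirectProduct.map (extendTuple T n) (extendPerm n) (by
    intro τ
    ext t i
    refine Fin.lastCases ?_ (fun j => ?_) i
    · have h : (extendPerm n τ)⁻¹ (Fin.last n) = Fin.last n := by
        rw [← map_inv, extendPerm_last]
      change (Fin.snoc (α := fun _ => T) _ 1 : Fin (n + 1) → T) (Fin.last n) =
        (Fin.snoc (α := fun _ => T) t 1 : Fin (n + 1) → T)
          ((extendPerm n τ)⁻¹ (Fin.last n))
      rw [h, Fin.snoc_last, Fin.snoc_last]
    · have h : (extendPerm n τ)⁻¹ j.castSucc = (τ⁻¹ j).castSucc := by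
        rw [← map_inv, extendPerm_castSucc]
      change (Fin.snoc (α := fun _ => T) (fun i => t (τ⁻¹ i)) 1 : Fin (n + 1) → T) j.castSucc =
        (Fin.snoc (α := fun _ => T) t 1 : Fin (n + 1) → T)
          ((extendPerm n τ)⁻¹ j.castSucc)
      rw [h, Fin.snoc_castSucc, Fin.snoc_castSucc])

theorem incl_injective (T : Type*) [Group T] (n : ℕ) : Function.Injective (incl T n) := by
  intro g h e
  have e1 : extendTuple T n g.left = extendTuple T n h.left :=
    congrArg SemidirectProduct.left e
  have e2 : extendPerm n g.right = extendPerm n h.right :=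
    congrArg SemidirectProduct.right e
  refine SemidirectProduct.ext ?_ (Equiv.Perm.viaEmbeddingHom_injective _ e2)
  funext i
  have := congrFun e1 i.castSucc
  simpa [extendTuple] using this

/-- The restriction map `E : ℂ[𝔖_{n+1}(T)] → ℂ[𝔖_n(T)]`, which keeps the coefficients at the
elements of `𝔖_n(T)` and drops all the others. -/
noncomputable def restrictE {T : Type*} [Group T] [Fintype T] {n : ℕ} (f : GroupAlg T (n + 1)) :
    GroupAlg T n :=
  ∑ h : Wreath T n, MonoidAlgebra.single h (f.coeff (incl T n h))

theorem restrictE_of_incl {T : Type*} [Group T] [Fintype T] {n : ℕ} (h : Wreath T n) :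
    restrictE (MonoidAlgebra.of ℂ (Wreath T (n + 1)) (incl T n h)) =
      MonoidAlgebra.of ℂ (Wreath T n) h := by
  classical
  unfold restrictE
  rw [Finset.sum_eq_single h]
  · simp
  · intro b _ hb
    have : incl T n h ≠ incl T n b := fun e => hb (incl_injective T n e).symm
    simp [this]
  · simp

theorem restrictE_of_notMem {T : Type*} [Group T] [Fintype T] {n : ℕ} (g : Wreath T (n + 1))
    (hg : g ∉ Set.range (incl T n)) :
    restrictE (MonoidAlgebra.of ℂ (Wreath T (n + 1)) g) = 0 := by
  classical
  unfold restrictE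
  refine Finset.sum_eq_zero fun b _ => ?_
  have : g ≠ incl T n b := fun e => hg ⟨b, e.symm⟩
  simp [this]

/-- The cycles (orbits, fixed points included) of a permutation, as subsets of `{1, …, n}`. -/
noncomputable def cycles {n : ℕ} (τ : Equiv.Perm (Fin n)) : Finset (Finset (Fin n)) :=
  open Classical in
  Finset.univ.image fun i => Finset.univ.filter fun j => τ.SameCycle i j

/-- The conjugacy type of `g = (t, τ) ∈ 𝔖_n(T)` for abelian `T`, where the conjugacy classes of
`T` are its elements: the `x`-entry is the Young diagram (the multiset of its row lengths) formed
by the lengths of the cycles of `τ`, fixed points included, along which the entries of `t` have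
product `x`. -/
noncomputable def type {T : Type*} [CommGroup T] {n : ℕ} (g : Wreath T n) : T → Multiset ℕ :=
  open Classical in
  fun x => ((cycles g.right).filter fun c => ∏ i ∈ c, g.left i = x).val.map Finset.card

/-- The conjugacy class `C_ρ` of `𝔖_n(T)` (`T` abelian): the elements of type `ρ`. -/
noncomputable def conjClass {T : Type*} [CommGroup T] [Fintype T] (n : ℕ) (ρ : T → Multiset ℕ) :
    Finset (Wreath T n) :=
  open Classical in Finset.univ.filter fun g => type g = ρ

/-- The normalized class indicator `A_{C_ρ} / |C_ρ|`, where `A_C = ∑_{g ∈ C} g`. -/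
noncomputable def normIndicator {T : Type*} [CommGroup T] [Fintype T] (n : ℕ)
    (ρ : T → Multiset ℕ) : GroupAlg T n :=
  ((conjClass n ρ).card : ℂ)⁻¹ • ∑ g ∈ conjClass n ρ, MonoidAlgebra.of ℂ (Wreath T n) g

/-- The map `ι_{n,m}` for `m = |ρ| ≤ n`: add `n - |ρ|` rows of length `1` to the entry of the unit
element. -/
noncomputable def iota {T : Type*} [CommGroup T] [Fintype T] (n : ℕ) (ρ : T → Multiset ℕ) :
    T → Multiset ℕ :=
  open Classical in
  fun x => if x = 1 then ρ x + Multiset.replicate (n - ∑ z : T, (ρ z).sum) 1 else ρ x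

/-- The (labelled) lengths of the nontrivial cycles of `g`, the labels being forgotten: all the
cycles of `g` except for the fixed points whose entry in `T` is the unit element. -/
noncomputable def nontrivialCycles {T : Type*} [CommGroup T] [Fintype T] {n : ℕ} (g : Wreath T n) :
    Multiset ℕ :=
  open Classical in
  ∑ x : T, if x = 1 then (type g x).filter (fun j => j ≠ 1) else type g x

/-- `Ȳ_k`: the Young diagrams of size `k` without rows of length `1`. -/
def diagramsNoOnes (k : ℕ) : Finset k.Partition :=
  Finset.univ.filter fun σ => 1 ∉ σ.parts

/-- The number of rows `l(σ)`. -/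
def len {k : ℕ} (σ : k.Partition) : ℕ := σ.parts.card

/-- `σ^×`, the rows of `σ` with the first column removed (empty rows are not recorded). -/
def removeColumn {k : ℕ} (σ : k.Partition) : Multiset ℕ :=
  (σ.parts.map fun j => j - 1).filter fun j => j ≠ 0

/-- A partition of `{1, …, k}` is non-crossing if `a < b < c < d` with `a, c` in one block and
`b, d` in one block only happens within a single block. -/
def IsNonCrossing {k : ℕ} (π : Finpartition (Finset.univ : Finset (Fin k))) : Prop :=
  ∀ B ∈ π.parts, ∀ C ∈ π.parts, ∀ a b c d : Fin k, a < b → b < c → c < d →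
    a ∈ B → c ∈ B → b ∈ C → d ∈ C → B = C

/-- `NC(σ)`: the non-crossing partitions of `{1, …, k}` whose block sizes are the rows of `σ`. -/
noncomputable def NC {k : ℕ} (σ : k.Partition) :
    Finset (Finpartition (Finset.univ : Finset (Fin k))) :=
  open Classical in
  Finset.univ.filter fun π => IsNonCrossing π ∧ π.parts.val.map Finset.card = σ.parts

/-- The ways to label the rows of the diagram `μ` by elements of `T` (up to the order of rows of
equal length) with product of all the labels equal to `y`. With `n_i^x = (ρ x).count i`, the
`x`-entry is the diagram `(1^{n_1^x} 2^{n_2^x} ⋯)`; the first condition says that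
`∑_{x ∈ T} n_i^x = m_i(μ)` for every `i`, so that the `1`-entry consists of the rows which are not
labelled by any `x ≠ 1`, and the second that `∏_x x^{n_1^x + n_2^x + ⋯} = y`. -/
noncomputable def labelings {T : Type*} [CommGroup T] [Fintype T] (μ : Multiset ℕ) (y : T) :
    Finset (T → Multiset ℕ) :=
  open Classical in
  (Fintype.piFinset fun _ : T => μ.powerset.toFinset).filter fun ρ =>
    ∑ x : T, ρ x = μ ∧ ∏ x : T, x ^ (ρ x).card = y

/-- The product over `i` of the multinomial coefficients `m_i(μ)! / ∏_{x ∈ T} n_i^x !` with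
`n_i^x = (ρ x).count i`, for a labelling `ρ` of the rows of `μ` (so that `∑_x n_i^x = m_i(μ)`);
only the row lengths `i` of `μ` contribute a factor other than `1`. -/
def multinomials {T : Type*} [Fintype T] (μ : Multiset ℕ) (ρ : T → Multiset ℕ) : ℕ :=
  ∏ i ∈ μ.toFinset, Nat.multinomial Finset.univ fun x : T => (ρ x).count i

end WreathJM

/-! Expanding `J^k` turns the restriction into a sum over words of `k` pairs (letter `w j`, label `x
j ∈ T`). The surviving words are those whose product fixes `n+1` and has entry `e_T` there.
Conjugation by `𝔖_n(T)` permutes the words, so the sum is central; elements of equal type are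
conjugate, so a conjugation-stable set of words of one type sums to a multiple of a normalized class
indicator.

Let `τ` be the permutation part of a surviving word. Following the image of `n+1` under the partial
products shows that every cycle `c` of `τ` that meets the word occupies at least `|c| + 1`
positions, because the letter at its first position must recur. Comparing signs gives `k = #letters
+ #cycles + 2δ` with `δ ≥ 0` (`Evaluates.exists_defect`), where only cycles meeting the word are
counted.

If `δ = 0`, the only repetition inside a cycle is between its first and its last position, and the
positions of the cycles form a noncrossing partition (`Evaluates.fits_of_card_eq`,
`Fits.isNonCrossing`). Conversely, a word repeating letters in this way along a noncrossing
partition without singletons fixes `n+1`, and a block `B` yields a cycle of length `|B| - 1`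
(`Fits.sameCycle_iff`), whence `σ^×`. For `l` blocks there are `n(n-1)⋯` (`k - l` factors) such
words `w`. The products of the labels along the cycles define a surjective homomorphism `T^k → T^l`
(`Fits.blockLabel_surjective`), so each choice of cycle products comes from `|T|^(k-l)` labellings,
and multinomial coefficients count the choices of a given type. The entry at `n+1` is trivial
exactly if the cycle products multiply to `y`. This is the main term; `ε` comes from replacing the
falling factorial by a power.

If `δ > 0`, the word is attributed to the diagram with a row `|c| + 1` for every cycle `c` that it
meets and `δ` further rows of length `2` (`IsValue.exists_diagram`). Then `l(σ) = #cycles + δ`, so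
only `k - l(σ) - δ` letters occur, and there are `O(n^(k-l(σ)-1))` such words. -/

namespace WreathJM

section

open scoped Classical

/-! ### Partial products of star transpositions and the orbit of the last letter -/

/-- The product of the first `j` of the transpositions `(w 0 *), (w 1 *), …`, where `*` is the
last letter. -/
def pre {n k : ℕ} (w : Fin k → Fin n) : ℕ → Equiv.Perm (Fin (n + 1))
  | 0 => 1
  | j + 1 => pre w j * if h : j < k then Equiv.swap (w ⟨j, h⟩).castSucc (Fin.last n) else 1

/-- The image of the last letter under the `j`th partial product. -/
def point {n k : ℕ} (w : Fin k → Fin n) (j : ℕ) : Fin (n + 1) := pre w j (Fin.last n)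

section Trajectory

variable {n k : ℕ} (w : Fin k → Fin n)

theorem pre_succ (j : Fin k) :
    pre w (j + 1) = pre w j * Equiv.swap (w j).castSucc (Fin.last n) := by
  simp [pre]

theorem point_zero : point w 0 = Fin.last n := rfl

theorem point_succ (j : Fin k) : point w (j + 1) = pre w j (w j).castSucc := by
  simp [point, pre_succ]

theorem pre_succ_apply_self (j : Fin k) : pre w (j + 1) (w j).castSucc = point w j := by
  simp [point, pre_succ]

/-- Right multiplication by the transposition `(w j *)` changes only the images of `w j` and `*`, so
the image of a letter is frozen between its occurrences. -/
theorem pre_apply_of_untouched {i : Fin n} {a b : ℕ} (hab : a ≤ b) (hb : b ≤ k)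
    (h : ∀ j : Fin k, a ≤ j → (j : ℕ) < b → w j ≠ i) :
    pre w b i.castSucc = pre w a i.castSucc := by
  induction b, hab using Nat.le_induction with
  | base => rfl
  | succ b hab ih =>
    have h1 := pre_succ w ⟨b, hb⟩
    simp only at h1
    rw [h1, Equiv.Perm.mul_apply, Equiv.swap_apply_of_ne_of_ne, ih (by omega)]
    · intro j h1 h2; exact h j h1 (by omega)
    · intro e
      exact h ⟨b, hb⟩ hab (by simp) (Fin.castSucc_injective _ e).symm
    · exact (Fin.castSucc_lt_last i).ne

theorem point_succ_of_first (j : Fin k) (h : ∀ i < j, w i ≠ w j) :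
    point w (j + 1) = (w j).castSucc := by
  rw [point_succ, pre_apply_of_untouched w (Nat.zero_le _) j.2.le (fun i _ hi => h i hi)]
  rfl

/-- At its previous occurrence the letter took over the current point as its image and has kept it
since; multiplying by the transposition again gives this point back. -/
theorem point_succ_of_prev {i j : Fin k} (hij : i < j) (e : w i = w j)
    (h : ∀ m, i < m → m < j → w m ≠ w j) : point w (j + 1) = point w i := by
  rw [point_succ, ← pre_succ_apply_self w i, e]
  exact pre_apply_of_untouched w hij j.2.le (fun m h1 h2 => h m h1 h2)

theorem pre_apply_of_last (j : Fin k) (h : ∀ i, j < i → w i ≠ w j) :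
    pre w k (w j).castSucc = point w j := by
  rw [← pre_succ_apply_self w j]
  exact pre_apply_of_untouched w j.2 le_rfl (fun m h1 _ => h m h1)

theorem pre_apply_of_notMem (i : Fin n) (h : ∀ j, w j ≠ i) :
    pre w k i.castSucc = i.castSucc :=
  pre_apply_of_untouched w (Nat.zero_le _) le_rfl fun j _ _ => h j

/-- By strong induction: a fresh letter becomes the point, while a repeated letter sends the point
back to an earlier one. -/
theorem point_eq (j : ℕ) (hj : j ≤ k) :
    point w j = Fin.last n ∨ ∃ i : Fin k, (i : ℕ) < j ∧ point w j = (w i).castSucc := by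
  induction j using Nat.strong_induction_on with
  | _ j ih =>
  rcases j with _ | j
  · exact Or.inl rfl
  by_cases hf : ∀ i < (⟨j, hj⟩ : Fin k), w i ≠ w ⟨j, hj⟩
  · exact Or.inr ⟨⟨j, hj⟩, Nat.lt_succ_self j, point_succ_of_first w ⟨j, hj⟩ hf⟩
  · push Not at hf
    obtain ⟨i0, hi0, e0⟩ := hf
    obtain ⟨m, hm, hmax⟩ := (Finset.univ.filter fun i : Fin k =>
      i < ⟨j, hj⟩ ∧ w i = w ⟨j, hj⟩).exists_max_image id ⟨i0, by simp [hi0, e0]⟩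
    simp only [Finset.mem_filter, Finset.mem_univ, true_and, id] at hm hmax
    have := point_succ_of_prev w hm.1 hm.2 fun i h1 h2 e => (hmax i ⟨h2, e⟩).not_gt h1
    simp only at this
    rw [this]
    have hlt : (m : ℕ) < j := hm.1
    rcases ih m (by omega) (by omega) with h | ⟨i, hi, h⟩
    · exact Or.inl h
    · exact Or.inr ⟨i, by omega, h⟩

theorem exists_last_occurrence (j : Fin k) : ∃ m, j ≤ m ∧ w m = w j ∧ ∀ i, m < i → w i ≠ w m := by
  let S := Finset.univ.filter fun i : Fin k => w i = w j
  have hj : j ∈ S := by simp [S]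
  have hm := S.max'_mem ⟨j, hj⟩
  simp only [S, Finset.mem_filter, Finset.mem_univ, true_and] at hm
  refine ⟨_, S.le_max' j hj, hm, fun i hi e => ?_⟩
  exact (S.le_max' i (by simp [S, e, hm])).not_gt hi

end Trajectory

/-- A permutation of `n + 1` letters fixing the last one restricts to the others. -/
theorem exists_extendPerm_eq {n : ℕ} (σ : Equiv.Perm (Fin (n + 1)))
    (h : σ (Fin.last n) = Fin.last n) : ∃ τ, extendPerm n τ = σ := by
  have hne : ∀ i : Fin n, σ i.castSucc ≠ Fin.last n := fun i e =>
    (Fin.castSucc_lt_last i).ne (σ.injective (e.trans h.symm))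
  have hinj : Function.Injective fun i : Fin n => (σ i.castSucc).castPred (hne i) := by
    intro i j e
    simpa using e
  refine ⟨Equiv.ofBijective _ (Finite.injective_iff_bijective.1 hinj), ?_⟩
  ext i
  refine Fin.lastCases ?_ (fun j => ?_) i
  · rw [extendPerm_last, h]
  · rw [extendPerm_castSucc]; simp

/-! ### Words whose product fixes the last letter -/

/-- The word `w` of star transpositions multiplies to `τ`, which fixes the last letter. -/
def Evaluates {n k : ℕ} (w : Fin k → Fin n) (τ : Equiv.Perm (Fin n)) : Prop :=
  extendPerm n τ = pre w k

namespace Evaluates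

variable {n k : ℕ} {w : Fin k → Fin n} {τ : Equiv.Perm (Fin n)} (h : Evaluates w τ)
include h

theorem castSucc_apply (i : Fin n) : (τ i).castSucc = pre w k i.castSucc := by
  rw [← h, extendPerm_castSucc]

theorem point_length : point w k = Fin.last n := by
  rw [point, ← h, extendPerm_last]

theorem apply_of_notMem (i : Fin n) (hi : ∀ j, w j ≠ i) : τ i = i := by
  apply Fin.castSucc_injective
  rw [h.castSucc_apply, pre_apply_of_notMem w i hi]

theorem apply_of_last (j : Fin k) (hj : ∀ i, j < i → w i ≠ w j) :
    (τ (w j)).castSucc = point w j := by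
  rw [h.castSucc_apply, pre_apply_of_last w j hj]

/-- The image is the current point. It is not `*`, since `τ` permutes the other letters, so it has
been used before. -/
theorem apply_of_last_eq (j : Fin k) (hj : ∀ i, j < i → w i ≠ w j) :
    ∃ i < j, τ (w j) = w i := by
  have h1 := h.apply_of_last j hj
  rcases point_eq w j j.2.le with h2 | ⟨i, hi, h2⟩
  · exact absurd (h1.trans h2) (Fin.castSucc_lt_last _).ne
  · exact ⟨i, hi, Fin.castSucc_injective _ (h1.trans h2)⟩

theorem sameCycle_letter {j : Fin k} {i : Fin n} (hi : τ.SameCycle (w j) i) : ∃ m, w m = i := by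
  by_contra hc
  push Not at hc
  have := hi.symm.eq_of_left (h.apply_of_notMem i hc)
  exact hc j this.symm

/-- The letter at the first position of a cycle occurs again. -/
theorem exists_ne_of_first (j : Fin k) (hj : ∀ i < j, ¬ τ.SameCycle (w i) (w j)) :
    ∃ i ≠ j, w i = w j := by
  by_contra hc
  push Not at hc
  -- Without a recurrence `j` is the last occurrence of `w j`, whose image is then an earlier letter
  -- of the same cycle.
  obtain ⟨i, hi, e⟩ := h.apply_of_last_eq j fun i hi => hc i hi.ne'
  refine hj i hi ?_
  rw [← e]
  exact Equiv.Perm.sameCycle_apply_left.2 (Equiv.Perm.SameCycle.refl _ _)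

/-- The letter at the last position of a cycle has occurred before. -/
theorem exists_ne_of_final (j : Fin k) (hj : ∀ i, j < i → ¬ τ.SameCycle (w i) (w j)) :
    ∃ i ≠ j, w i = w j := by
  have hs : τ.SameCycle (w j) (τ⁻¹ (w j)) :=
    ⟨-1, by simp⟩
  obtain ⟨m, hm⟩ := h.sameCycle_letter hs
  obtain ⟨l, -, hl, hlast⟩ := exists_last_occurrence w m
  -- As `l` is the last occurrence of the preimage of `w j`, the letter `w j` occurs at some `i <
  -- l`. No position after `j` belongs to the cycle, so `i ≠ j`.
  obtain ⟨i, hi, e⟩ := h.apply_of_last_eq l hlast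
  rw [hl, hm] at e
  simp only [Equiv.Perm.inv_def, Equiv.apply_symm_apply] at e
  refine ⟨i, ?_, e.symm⟩
  rintro rfl
  exact hj l hi (by rw [hl, hm]; exact hs.symm)

end Evaluates

/-! ### Blocks, gaps and noncrossing partitions -/

section Blocks

variable {k : ℕ} (π : Finpartition (Finset.univ : Finset (Fin k)))

theorem mem_part_self (i : Fin k) : i ∈ π.part i := (π.mem_part_self).2 (Finset.mem_univ i)

theorem mem_part_iff (i j : Fin k) : i ∈ π.part j ↔ π.part i = π.part j :=
  π.mem_part_iff_part_eq_part (Finset.mem_univ i) (Finset.mem_univ j)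

theorem part_mem_parts (i : Fin k) : π.part i ∈ π.parts := π.part_mem.2 (Finset.mem_univ i)

/-- The smallest element of the block of `i`. -/
noncomputable def blockMin (i : Fin k) : Fin k := (π.part i).min' ⟨i, mem_part_self π i⟩

/-- The largest element of the block of `i`. -/
noncomputable def blockMax (i : Fin k) : Fin k := (π.part i).max' ⟨i, mem_part_self π i⟩

theorem part_blockMin (i : Fin k) : π.part (blockMin π i) = π.part i :=
  (mem_part_iff π _ _).1 (Finset.min'_mem _ _)

theorem part_blockMax (i : Fin k) : π.part (blockMax π i) = π.part i :=
  (mem_part_iff π _ _).1 (Finset.max'_mem _ _)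

variable {π}

theorem blockMin_le {i j : Fin k} (h : π.part i = π.part j) : blockMin π i ≤ j :=
  Finset.min'_le _ _ ((mem_part_iff π _ _).2 h.symm)

theorem le_blockMax {i j : Fin k} (h : π.part i = π.part j) : j ≤ blockMax π i :=
  Finset.le_max' _ _ ((mem_part_iff π _ _).2 h.symm)

theorem blockMin_congr {i j : Fin k} (h : π.part i = π.part j) : blockMin π i = blockMin π j := by
  simp only [blockMin, h]

theorem blockMax_congr {i j : Fin k} (h : π.part i = π.part j) : blockMax π i = blockMax π j := by
  simp only [blockMax, h]

variable (π)

/-- Identifies the last position of every block with the first one. -/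
noncomputable def rep (i : Fin k) : Fin k := if i = blockMax π i then blockMin π i else i

/-- No block is a singleton. -/
def NoSingletons : Prop := ∀ B ∈ π.parts, B.card ≠ 1

/-- The word `w` uses the same letter at the first and at the last position of every block of `π`,
and different letters otherwise. -/
def Fits {n : ℕ} (w : Fin k → Fin n) : Prop := ∀ i j, w i = w j ↔ rep π i = rep π j

/-- `u < v` are consecutive elements of a block. -/
def Gap (u v : Fin k) : Prop :=
  u < v ∧ π.part u = π.part v ∧ ∀ r, u < r → r < v → π.part r ≠ π.part u

variable {π}

theorem part_rep (i : Fin k) : π.part (rep π i) = π.part i := by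
  unfold rep
  split
  · exact part_blockMin π i
  · rfl

theorem rep_of_ne {i : Fin k} (h : i ≠ blockMax π i) : rep π i = i := if_neg h

theorem rep_blockMax (i : Fin k) : rep π (blockMax π i) = blockMin π i := by
  have h := part_blockMax π i
  rw [rep, if_pos (blockMax_congr h).symm, blockMin_congr h]

theorem NoSingletons.blockMin_lt (h : NoSingletons π) (i : Fin k) :
    blockMin π i < blockMax π i := by
  refine Finset.min'_lt_max'_of_card _ ?_
  have h0 := h _ (part_mem_parts π i)
  have := Finset.card_pos.2 ⟨i, mem_part_self π i⟩
  omega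

theorem NoSingletons.rep_blockMin (h : NoSingletons π) (i : Fin k) :
    rep π (blockMin π i) = blockMin π i :=
  rep_of_ne (by rw [blockMax_congr (part_blockMin π i)]; exact (h.blockMin_lt i).ne)

theorem NoSingletons.rep_rep (h : NoSingletons π) (i : Fin k) : rep π (rep π i) = rep π i := by
  by_cases hi : i = blockMax π i
  · have : rep π i = blockMin π i := if_pos hi
    rw [this, h.rep_blockMin]
  · rw [rep_of_ne hi, rep_of_ne hi]

theorem exists_gap {a q b : Fin k} (haq : a < q) (hqb : q < b) (hab : π.part a = π.part b)
    (hq : π.part q ≠ π.part a) :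
    ∃ u v, Gap π u v ∧ π.part u = π.part a ∧ a ≤ u ∧ u < q ∧ q < v ∧ v ≤ b := by
  obtain ⟨u, hu, hu'⟩ := (Finset.univ.filter fun i : Fin k =>
    i < q ∧ π.part i = π.part a).exists_max_image id ⟨a, by simp [haq]⟩
  obtain ⟨v, hv, hv'⟩ := (Finset.univ.filter fun i : Fin k =>
    q < i ∧ π.part i = π.part a).exists_min_image id ⟨b, by simp [hqb, hab]⟩
  simp only [Finset.mem_filter, Finset.mem_univ, true_and, id] at hu hu' hv hv'
  refine ⟨u, v, ⟨hu.1.trans hv.1, hu.2.trans hv.2.symm, fun r h1 h2 e => ?_⟩, hu.2,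
    hu' a ⟨haq, rfl⟩, hu.1, hv.1, hv' b ⟨hqb, hab.symm⟩⟩
  rw [hu.2] at e
  rcases lt_trichotomy r q with h | h | h
  · exact (hu' r ⟨h, e⟩).not_gt h1
  · exact hq (h ▸ e)
  · exact (hv' r ⟨h, e⟩).not_gt h2

theorem exists_gap_left {v : Fin k} (hv : v ≠ blockMin π v) : ∃ u, Gap π u v := by
  have hlt : blockMin π v < v := lt_of_le_of_ne (blockMin_le rfl) hv.symm
  obtain ⟨u, hu, hu'⟩ := (Finset.univ.filter fun i : Fin k =>
    i < v ∧ π.part i = π.part v).exists_max_image id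
      ⟨blockMin π v, by simp [hlt, part_blockMin]⟩
  simp only [Finset.mem_filter, Finset.mem_univ, true_and, id] at hu hu'
  exact ⟨u, hu.1, hu.2, fun r h1 h2 e => (hu' r ⟨h2, e.trans hu.2⟩).not_gt h1⟩

theorem Gap.ne_blockMax {u v : Fin k} (h : Gap π u v) : u ≠ blockMax π u :=
  (h.1.trans_le (le_blockMax h.2.1)).ne

theorem Gap.ne_blockMin {u v : Fin k} (h : Gap π u v) : v ≠ blockMin π v :=
  ((blockMin_le h.2.1.symm).trans_lt h.1).ne'

theorem IsNonCrossing.part_eq (hπ : IsNonCrossing π) {a b c d : Fin k} (hab : a < b) (hbc : b < c)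
    (hcd : c < d) (hac : π.part a = π.part c) (hbd : π.part b = π.part d) :
    π.part a = π.part b :=
  hπ _ (part_mem_parts π a) _ (part_mem_parts π b) a b c d hab hbc hcd (mem_part_self π a)
    ((mem_part_iff π _ _).2 hac.symm) (mem_part_self π b) ((mem_part_iff π _ _).2 hbd.symm)

/-- The blocks lying between consecutive elements of a block of a noncrossing partition. -/
theorem IsNonCrossing.between (hπ : IsNonCrossing π) {u v : Fin k} (h : Gap π u v) {q r : Fin k}
    (h1 : u < q) (h2 : q < v) (hr : π.part r = π.part q) : u < r ∧ r < v := by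
  have hne := h.2.2 q h1 h2
  constructor
  · by_contra hc
    rcases lt_or_eq_of_le (not_lt.1 hc) with h3 | h3
    · exact hne ((hπ.part_eq h3 h1 h2 hr h.2.1).symm.trans hr |>.symm)
    · exact hne (h3 ▸ hr.symm)
  · by_contra hc
    rcases lt_or_eq_of_le (not_lt.1 hc) with h3 | h3
    · exact hne (hπ.part_eq h1 h2 h3 h.2.1 hr.symm).symm
    · exact hne (hr.symm.trans (h3 ▸ h.2.1.symm))

/-- In a crossing `a < b < c < d`, the position `b` lies in a gap of the block of `a` and `c`, and
this gap ends before `d`. -/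
theorem isNonCrossing_of_gap
    (H : ∀ u v, Gap π u v → ∀ q, u < q → q < v → ∀ r, π.part r = π.part q → u < r ∧ r < v) :
    IsNonCrossing π := by
  intro B hB C hC a b c d hab hbc hcd ha hc hb hd
  rw [← π.part_eq_of_mem hB ha, ← π.part_eq_of_mem hC hb]
  have hac : π.part a = π.part c := by rw [π.part_eq_of_mem hB ha, π.part_eq_of_mem hB hc]
  have hbd : π.part b = π.part d := by rw [π.part_eq_of_mem hC hb, π.part_eq_of_mem hC hd]
  by_contra hne
  obtain ⟨u, v, hg, -, -, h1, h2, h3⟩ := exists_gap hab hbc hac (Ne.symm hne)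
  exact ((H u v hg b h1 h2 d hbd.symm).2.trans_le h3).not_ge hcd.le

end Blocks

/-! ### Fitting words: the product has the blocks as cycles exactly in the noncrossing case -/

section FittingWords

variable {n k : ℕ} {w : Fin k → Fin n} {π : Finpartition (Finset.univ : Finset (Fin k))}
  (hf : Fits π w) (hs : NoSingletons π)
include hf

theorem Fits.part_eq {i j : Fin k} (h : w i = w j) : π.part i = π.part j := by
  rw [← part_rep i, (hf i j).1 h, part_rep]


/-- Every position except the last one of a block carries a fresh letter. -/
theorem Fits.point_succ {j : Fin k} (hj : j ≠ blockMax π j) :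
    point w (j + 1) = (w j).castSucc := by
  refine point_succ_of_first w j fun i hi e => ?_
  have hp := hf.part_eq e
  have h := (hf i j).1 e
  rw [rep_of_ne hj] at h
  by_cases him : i = blockMax π i
  · exact hi.not_ge (him ▸ le_blockMax hp)
  · rw [rep_of_ne him] at h
    exact hi.ne h

theorem Fits.last {j : Fin k} (hj : j ≠ blockMin π j) : ∀ i, j < i → w i ≠ w j := by
  intro i hi e
  have hp := hf.part_eq e
  have h := (hf i j).1 e
  by_cases hjm : j = blockMax π j
  · exact hi.not_ge (hjm ▸ le_blockMax hp.symm)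
  · rw [rep_of_ne hjm] at h
    by_cases him : i = blockMax π i
    · rw [him, rep_blockMax, blockMin_congr hp] at h
      exact hj h.symm
    · rw [rep_of_ne him] at h
      exact hi.ne' h

include hs

theorem Fits.blockMin_eq_blockMax (i : Fin k) : w (blockMin π i) = w (blockMax π i) := by
  rw [hf, hs.rep_blockMin, rep_blockMax]

/-- The last position repeats the letter of the first one, so closing a block restores the point
from before the block was opened. -/
theorem Fits.point_blockMax_succ (j : Fin k) :
    point w (blockMax π j + 1) = point w (blockMin π j) := by
  refine point_succ_of_prev w (hs.blockMin_lt j) (hf.blockMin_eq_blockMax hs j) fun m h1 h2 e => ?_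
  have h := (hf _ _).1 e
  have hp := (hf.part_eq e).trans (part_blockMax π j)
  rw [rep_blockMax, rep_of_ne (by rw [blockMax_congr hp]; exact h2.ne)] at h
  exact h1.ne h.symm

/-- A fitting word whose product has the blocks for cycles comes from a noncrossing partition. -/
theorem Fits.isNonCrossing {τ : Equiv.Perm (Fin n)} (hτ : Evaluates w τ)
    (hc : ∀ i j, τ.SameCycle (w i) (w j) ↔ π.part i = π.part j) : IsNonCrossing π := by
  have ctx_prev : ∀ j : Fin k, j ≠ blockMin π j →
      ∃ i, π.part i = π.part j ∧ point w j = (w i).castSucc := by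
    intro j hj
    have e := hτ.apply_of_last j (hf.last hj)
    obtain ⟨i, -, e'⟩ := hτ.apply_of_last_eq j (hf.last hj)
    refine ⟨i, ?_, by rw [← e, e']⟩
    rw [← hc, ← e']
    exact Equiv.Perm.sameCycle_apply_left.2 (Equiv.Perm.SameCycle.refl _ _)
  refine isNonCrossing_of_gap fun u v => ?_
  -- Induction on the right end suffices because the gaps of other blocks met on the way down end
  -- before `v`.
  induction v using WellFoundedLT.induction generalizing u with
  | _ v ih =>
  intro h
  -- descend from `v`, skipping complete blocks
  have descend : ∀ j : ℕ, (u : ℕ) < j → j ≤ v →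
      (∃ i, π.part i = π.part v ∧ point w j = (w i).castSucc) →
      (∀ q : Fin k, j ≤ q → q < v → ∀ r, π.part r = π.part q → u < r ∧ r < v) →
      ∀ q, u < q → q < v → ∀ r, π.part r = π.part q → u < r ∧ r < v := by
    intro j
    induction j using Nat.strong_induction_on with
    | _ j ihj =>
    rintro huj hjv ⟨i, hi, hpt⟩ hcl
    obtain ⟨m, rfl⟩ : ∃ m : Fin k, j = m + 1 := ⟨⟨j - 1, by omega⟩, by simp; omega⟩
    have hum : u ≤ m := by have : (u : ℕ) ≤ m := by omega
                           exact this
    have hmv : m < v := hjv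
    rcases hum.eq_or_lt with rfl | hum
    · intro q h1 h2
      exact hcl q h1 h2
    have hmne := h.2.2 m hum hmv
    -- Otherwise the point after `m` would be `w m`, putting `m` into the block of `v`, which is
    -- that of `u`.
    have hmax : m = blockMax π m := by
      by_contra hm
      rw [hf.point_succ hm] at hpt
      exact hmne ((hf.part_eq (Fin.castSucc_injective _ hpt)).trans (hi.trans h.2.1.symm))
    have hlt : blockMin π m < m := by conv_rhs => rw [hmax]
                                      exact hs.blockMin_lt m
    have hpt' : point w (m + 1) = point w (blockMin π m) := by
      rw [← hf.point_blockMax_succ hs m, ← hmax]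
    -- If `u` lay strictly inside the span of the block of `m`, a gap of that block ending before
    -- `v` would contain `u`; by induction it would contain the whole block of `u`, hence `v`.
    have humin : u < blockMin π m := by
      by_contra hcon
      rcases (not_lt.1 hcon).eq_or_lt with e | hlt'
      · exact hmne (by rw [← part_blockMin π m, e])
      · obtain ⟨u', v', hg, -, -, h1, h2, h3⟩ :=
          exists_gap hlt' hum (part_blockMin π m) (by rw [part_blockMin]; exact hmne.symm)
        have := (ih v' (h3.trans_lt hmv) u' hg u h1 h2 v h.2.1.symm).2
        exact (this.trans_le h3).not_gt hmv
    refine ihj (blockMin π m) ?_ humin (hlt.trans hmv).le ⟨i, hi, by rw [← hpt', hpt]⟩ ?_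
    · have : (blockMin π m : ℕ) < m := hlt
      omega
    · intro q h1 h2 r hr
      rcases Nat.lt_or_ge m q with h3 | h3
      · exact hcl q h3 h2 r hr
      by_cases hqm : π.part q = π.part m
      · refine ⟨humin.trans_le (blockMin_le (hr.trans hqm).symm), ?_⟩
        exact (le_blockMax (hr.trans hqm).symm).trans_lt (hmax ▸ hmv)
      · have hq1 : blockMin π m < q :=
          lt_of_le_of_ne h1 fun e => hqm (by rw [← e, part_blockMin])
        have hq2 : q < m := lt_of_le_of_ne h3 fun e => hqm (by rw [e])
        obtain ⟨u', v', hg, -, h0, h4, h5, h6⟩ :=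
          exists_gap hq1 hq2 (part_blockMin π m) (by rw [part_blockMin]; exact hqm)
        have := ih v' (h6.trans_lt hmv) u' hg q h4 h5 r hr
        exact ⟨(humin.trans_le h0).trans this.1, (this.2.trans_le h6).trans hmv⟩
  exact descend v h.1 le_rfl (ctx_prev v h.ne_blockMin) fun q h1 h2 => absurd h2 (not_lt.2 h1)

/-- In a noncrossing fitting word, a run of complete blocks does not move the current letter. -/
theorem Fits.point_eq_of_closed (hπ : IsNonCrossing π) (a j : ℕ) (haj : a ≤ j) (hj : j ≤ k)
    (hcl : ∀ q : Fin k, a ≤ q → (q : ℕ) < j → ∀ r, π.part r = π.part q → a ≤ r ∧ (r : ℕ) < j) :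
    point w j = point w a := by
  induction j using Nat.strong_induction_on with
  | _ j ih =>
  rcases haj.eq_or_lt with rfl | haj
  · rfl
  obtain ⟨m, rfl⟩ : ∃ m : Fin k, j = m + 1 := ⟨⟨j - 1, by omega⟩, by simp; omega⟩
  have hmm := hcl m (by omega) (by omega)
  have hmax : m = blockMax π m :=
    le_antisymm (le_blockMax rfl) (by have := (hmm _ (part_blockMax π m)).2; omega)
  have hmin := (hmm _ (part_blockMin π m)).1
  have hlt : blockMin π m < m := by conv_rhs => rw [hmax]
                                    exact hs.blockMin_lt m
  have hlt' : (blockMin π m : ℕ) < m := hlt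
  have e1 : point w (m + 1) = point w (blockMin π m) := by
    rw [← hf.point_blockMax_succ hs m, ← hmax]
  rw [e1]
  -- After removal of the span of the last block, the run still consists of complete blocks: a block
  -- reaching from the remaining run into that span would cross the block of `m`.
  refine ih _ (by omega) hmin (by omega) fun q h1 h2 r hr => ?_
  obtain ⟨h3, h4⟩ := hcl q h1 (by omega) r hr
  refine ⟨h3, ?_⟩
  by_contra hc
  have hc' : blockMin π m ≤ r := by simpa using hc
  have h2' : q < blockMin π m := h2
  have hrm : r ≤ m := by have : (r : ℕ) ≤ m := by omega
                         exact this
  have hne : π.part q ≠ π.part m := fun e => (blockMin_le e.symm).not_gt h2'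
  rcases hc'.eq_or_lt with h5 | h5
  · exact hne (by rw [← hr, ← h5, part_blockMin])
  rcases hrm.eq_or_lt with h6 | h6
  · exact hne (by rw [← hr, ← h6])
  · exact hne ((hπ.part_eq h2' h5 h6 hr.symm (part_blockMin π m)).trans (part_blockMin π m))

theorem Fits.point_length (hπ : IsNonCrossing π) : point w k = Fin.last n := by
  rw [hf.point_eq_of_closed hs hπ 0 k (Nat.zero_le _) le_rfl fun q _ _ r _ => ⟨Nat.zero_le _, r.2⟩,
    point_zero]

theorem Fits.exists_evaluates (hπ : IsNonCrossing π) : ∃ τ, Evaluates w τ :=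
  exists_extendPerm_eq _ (hf.point_length hs hπ)

/-- The interior of a gap consists of complete blocks, so the point reached at `v` is still the
letter `w u` entered at `u`. Thus `τ` runs through each block backwards. -/
theorem Fits.apply_of_gap (hπ : IsNonCrossing π) {τ : Equiv.Perm (Fin n)} (hτ : Evaluates w τ)
    {u v : Fin k} (h : Gap π u v) : τ (w v) = w u := by
  apply Fin.castSucc_injective
  rw [hτ.apply_of_last v (hf.last h.ne_blockMin), ← hf.point_succ h.ne_blockMax]
  refine hf.point_eq_of_closed hs hπ _ _ h.1 v.2.le fun q h1 h2 r hr => ?_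
  exact hπ.between h h1 h2 hr

theorem Fits.sameCycle_iff (hπ : IsNonCrossing π) {τ : Equiv.Perm (Fin n)} (hτ : Evaluates w τ)
    (i j : Fin k) : τ.SameCycle (w i) (w j) ↔ π.part i = π.part j := by
  constructor
  · intro h
    have key : ∀ a : Fin k, ∃ b, π.part b = π.part a ∧ τ (w a) = w b := by
      intro a
      by_cases ha : a = blockMin π a
      -- The first position has no predecessor in its block; its letter is read at the last position
      -- instead, which closes the cycle.
      · have e : w a = w (blockMax π a) := by
          conv_lhs => rw [ha]
          exact hf.blockMin_eq_blockMax hs a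
        have hne : blockMax π a ≠ blockMin π (blockMax π a) := by
          rw [blockMin_congr (part_blockMax π a)]
          exact (hs.blockMin_lt a).ne'
        obtain ⟨u, hu⟩ := exists_gap_left hne
        exact ⟨u, hu.2.1.trans (part_blockMax π a), e ▸ hf.apply_of_gap hs hπ hτ hu⟩
      · obtain ⟨u, hu⟩ := exists_gap_left ha
        exact ⟨u, hu.2.1, hf.apply_of_gap hs hπ hτ hu⟩
    obtain ⟨m, hm⟩ := h.exists_nat_pow_eq
    have : ∀ m : ℕ, ∃ b, π.part b = π.part i ∧ (τ ^ m) (w i) = w b := by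
      intro m
      induction m with
      | zero => exact ⟨i, rfl, rfl⟩
      | succ m ih =>
        obtain ⟨b, hb, e⟩ := ih
        obtain ⟨c, hc, e'⟩ := key b
        exact ⟨c, hc.trans hb, by rw [pow_succ', Equiv.Perm.mul_apply, e, e']⟩
    obtain ⟨b, hb, e⟩ := this m
    rw [hm] at e
    rw [← hb, hf.part_eq e]
  · have key : ∀ v : Fin k, τ.SameCycle (w v) (w (blockMin π v)) := by
      intro v
      induction v using WellFoundedLT.induction with
      | _ v ih =>
      by_cases hv : v = blockMin π v
      · rw [← hv]
      · obtain ⟨u, hu⟩ := exists_gap_left hv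
        have := ih u hu.1
        rw [blockMin_congr hu.2.1, ← hf.apply_of_gap hs hπ hτ hu] at this
        exact Equiv.Perm.sameCycle_apply_left.1 this
    intro h
    have := key j
    rw [← blockMin_congr h] at this
    exact (key i).trans this.symm

end FittingWords

/-! ### Cycles as sets, and the sign -/

/-- The cycle of `i`, as a set. -/
noncomputable def cyc {n : ℕ} (τ : Equiv.Perm (Fin n)) (i : Fin n) : Finset (Fin n) :=
  Finset.univ.filter fun j => τ.SameCycle i j

section Cyc

variable {n : ℕ} {τ : Equiv.Perm (Fin n)}

theorem cycles_eq_image : cycles τ = Finset.univ.image (cyc τ) := rfl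

theorem mem_cyc {i j : Fin n} : j ∈ cyc τ i ↔ τ.SameCycle i j := by simp [cyc]

theorem self_mem_cyc (i : Fin n) : i ∈ cyc τ i := mem_cyc.2 (Equiv.Perm.SameCycle.refl _ _)

theorem cyc_eq_iff {i j : Fin n} : cyc τ i = cyc τ j ↔ τ.SameCycle i j := by
  constructor
  · intro h
    rw [← mem_cyc, h]
    exact self_mem_cyc j
  · intro h
    ext m
    rw [mem_cyc, mem_cyc]
    exact ⟨fun h' => h.symm.trans h', fun h' => h.trans h'⟩

theorem cyc_eq_singleton {i : Fin n} (h : τ i = i) : cyc τ i = {i} := by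
  ext j
  rw [mem_cyc, Finset.mem_singleton]
  constructor
  · intro h'
    exact (h'.eq_of_left h).symm
  · rintro rfl
    exact Equiv.Perm.SameCycle.refl _ _

theorem support_cycleOf_eq_cyc {i : Fin n} (h : τ i ≠ i) : (τ.cycleOf i).support = cyc τ i := by
  ext j
  rw [Equiv.Perm.mem_support_cycleOf_iff, mem_cyc, Equiv.Perm.mem_support]
  exact ⟨fun h' => h'.1, fun h' => ⟨h', h⟩⟩

theorem apply_ne_of_card_cyc {i : Fin n} (h : (cyc τ i).card ≠ 1) : τ i ≠ i := fun e => h (by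
  rw [cyc_eq_singleton e, Finset.card_singleton])

theorem card_cyc_ne_one {i : Fin n} (h : τ i ≠ i) : (cyc τ i).card ≠ 1 := by
  intro e
  obtain ⟨a, ha⟩ := Finset.card_eq_one.1 e
  have h1 := self_mem_cyc (τ := τ) i
  have h2 : τ i ∈ cyc τ i :=
    mem_cyc.2 (Equiv.Perm.sameCycle_apply_right.2 (Equiv.Perm.SameCycle.refl _ _))
  rw [ha, Finset.mem_singleton] at h1 h2
  exact h (h2.trans h1.symm)

theorem image_support_cycleFactorsFinset :
    τ.cycleFactorsFinset.image Equiv.Perm.support = (cycles τ).filter fun c => c.card ≠ 1 := by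
  ext c
  simp only [Finset.mem_image, Finset.mem_filter, cycles_eq_image, Finset.mem_univ, true_and]
  constructor
  · rintro ⟨f, hf, rfl⟩
    obtain ⟨x, hx⟩ := (Equiv.Perm.mem_cycleFactorsFinset_iff.1 hf).1.nonempty_support
    have hτ : τ x ≠ x := by
      rw [← (Equiv.Perm.mem_cycleFactorsFinset_iff.1 hf).2 x hx]
      exact Equiv.Perm.mem_support.1 hx
    have e := support_cycleOf_eq_cyc hτ
    rw [← Equiv.Perm.cycle_is_cycleOf hx hf] at e
    exact ⟨⟨x, e.symm⟩, e ▸ card_cyc_ne_one hτ⟩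
  · rintro ⟨⟨i, rfl⟩, h⟩
    have hi := apply_ne_of_card_cyc h
    exact ⟨τ.cycleOf i, Equiv.Perm.cycleOf_mem_cycleFactorsFinset_iff.2
      (Equiv.Perm.mem_support.2 hi), support_cycleOf_eq_cyc hi⟩

/-- A cycle of length `c` has sign `(-1)^(c+1)`. This form matches the sum of `|c| + 1` over the
cycles meeting a word. -/
theorem sign_eq_sum_cycles :
    Equiv.Perm.sign τ = (-1) ^ ∑ c ∈ (cycles τ).filter fun c => c.card ≠ 1, (c.card + 1) := by
  rw [Equiv.Perm.sign_of_cycleType, ← image_support_cycleFactorsFinset, Finset.sum_image]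
  · rw [Equiv.Perm.cycleType_def, Finset.sum_add_distrib]
    rw [Multiset.card_map, ← Finset.card_eq_sum_ones]
    rfl
  · intro f hf g hg e
    obtain ⟨x, hx⟩ := (Equiv.Perm.mem_cycleFactorsFinset_iff.1 hf).1.nonempty_support
    have hx' : x ∈ g.support := by
      have : f.support = g.support := e
      rwa [← this]
    rw [Equiv.Perm.cycle_is_cycleOf hx hf, Equiv.Perm.cycle_is_cycleOf hx' hg]

end Cyc

theorem sign_pre {n k : ℕ} (w : Fin k → Fin n) (j : ℕ) (hj : j ≤ k) :
    Equiv.Perm.sign (pre w j) = (-1) ^ j := by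
  induction j with
  | zero => simp [pre]
  | succ j ih =>
    have h1 := pre_succ w ⟨j, hj⟩
    simp only at h1
    rw [h1, map_mul, ih (by omega), Equiv.Perm.sign_swap (Fin.castSucc_lt_last _).ne, pow_succ]

/-! ### The defect of a word and the words of defect zero -/

/-- The cycles of `τ` containing a letter of `w`. -/
noncomputable def active {n k : ℕ} (w : Fin k → Fin n) (τ : Equiv.Perm (Fin n)) :
    Finset (Finset (Fin n)) :=
  Finset.univ.image fun j => cyc τ (w j)

/-- The set of letters of `w`. -/
noncomputable def letters {n k : ℕ} (w : Fin k → Fin n) : Finset (Fin n) := Finset.univ.image w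

/-- The positions of `w` whose letter belongs to the cycle `c`. -/
noncomputable def positions {n k : ℕ} (w : Fin k → Fin n) (τ : Equiv.Perm (Fin n))
    (c : Finset (Fin n)) : Finset (Fin k) :=
  Finset.univ.filter fun j => cyc τ (w j) = c

/-- The partition of the positions of a word according to the cycle containing the letter. -/
noncomputable def cyclePartition {n k : ℕ} (w : Fin k → Fin n) (τ : Equiv.Perm (Fin n)) :
    Finpartition (Finset.univ : Finset (Fin k)) :=
  Finpartition.ofSetoid (Setoid.ker fun j => cyc τ (w j))

theorem part_cyclePartition_eq_iff {n k : ℕ} {w : Fin k → Fin n} {τ : Equiv.Perm (Fin n)}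
    {i j : Fin k} : (cyclePartition w τ).part i = (cyclePartition w τ).part j ↔
      τ.SameCycle (w i) (w j) := by
  rw [← cyc_eq_iff, ← mem_part_iff, cyclePartition, Finpartition.mem_part_ofSetoid_iff_rel]
  exact eq_comm

theorem part_cyclePartition {n k : ℕ} {w : Fin k → Fin n} {τ : Equiv.Perm (Fin n)}
    (i : Fin k) : (cyclePartition w τ).part i = positions w τ (cyc τ (w i)) := by
  ext j
  rw [mem_part_iff, part_cyclePartition_eq_iff, positions, Finset.mem_filter, cyc_eq_iff]
  simp

namespace Evaluates

variable {n k : ℕ} {w : Fin k → Fin n} {τ : Equiv.Perm (Fin n)} (h : Evaluates w τ)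
include h

theorem sign_eq : Equiv.Perm.sign τ = (-1) ^ k := by
  rw [← sign_pre w k le_rfl, ← h]
  simp only [extendPerm, Equiv.Perm.viaEmbeddingHom_apply, Equiv.Perm.viaEmbedding]
  rw [Equiv.Perm.sign_extendDomain]

theorem image_positions (j : Fin k) :
    (positions w τ (cyc τ (w j))).image w = cyc τ (w j) := by
  ext i
  simp only [positions, Finset.mem_image, Finset.mem_filter, Finset.mem_univ, true_and, cyc_eq_iff,
    mem_cyc]
  constructor
  · rintro ⟨a, ha, rfl⟩
    exact ha.symm
  · intro hi
    obtain ⟨m, rfl⟩ := h.sameCycle_letter hi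
    exact ⟨m, hi.symm, rfl⟩

theorem card_letters : ∑ c ∈ active w τ, c.card = (letters w).card := by
  rw [Finset.card_eq_sum_card_fiberwise (f := cyc τ) (t := active w τ)]
  · refine Finset.sum_congr rfl fun c hc => ?_
    congr 1
    simp only [active, Finset.mem_image, Finset.mem_univ, true_and] at hc
    obtain ⟨j, rfl⟩ := hc
    ext i
    simp only [letters, Finset.mem_filter, Finset.mem_image, Finset.mem_univ, true_and,
      cyc_eq_iff, mem_cyc]
    exact ⟨fun hi => ⟨h.sameCycle_letter hi, hi.symm⟩, fun hi => hi.2.symm⟩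
  · intro i hi
    simp only [letters, Finset.coe_image, Finset.coe_univ, Set.image_univ, Set.mem_range] at hi
    obtain ⟨j, rfl⟩ := hi
    simp [active]

omit h in
theorem sum_card_positions : ∑ c ∈ active w τ, (positions w τ c).card = k := by
  conv_rhs => rw [← Fintype.card_fin k, ← Finset.card_univ]
  rw [Finset.card_eq_sum_card_fiberwise (f := fun j => cyc τ (w j)) (t := active w τ)]
  · rfl
  · intro i _
    simp [active]

/-- The first and the last letter of a cycle occur at least twice. -/
theorem exists_ne_of_extreme (i : Fin k) :
    (∃ m ≠ blockMin (cyclePartition w τ) i, w m = w (blockMin (cyclePartition w τ) i)) ∧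
    (∃ m ≠ blockMax (cyclePartition w τ) i, w m = w (blockMax (cyclePartition w τ) i)) := by
  constructor
  · refine h.exists_ne_of_first _ fun m hm hs => ?_
    rw [← part_cyclePartition_eq_iff, part_blockMin] at hs
    exact (blockMin_le hs.symm).not_gt hm
  · refine h.exists_ne_of_final _ fun m hm hs => ?_
    rw [← part_cyclePartition_eq_iff, part_blockMax] at hs
    exact (le_blockMax hs.symm).not_gt hm

/-- The positions of a cycle map onto it by `w`, but not injectively, since the letter at the first
of them recurs. -/
theorem card_lt_positions {c : Finset (Fin n)} (hc : c ∈ active w τ) :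
    c.card + 1 ≤ (positions w τ c).card := by
  simp only [active, Finset.mem_image, Finset.mem_univ, true_and] at hc
  obtain ⟨j, rfl⟩ := hc
  have h1 := h.image_positions j
  obtain ⟨m, hm, e⟩ := (h.exists_ne_of_extreme j).1
  refine lt_of_le_of_ne (h1 ▸ Finset.card_image_le) fun hcard => ?_
  conv_lhs at hcard => rw [← h1]
  have hinj := Finset.card_image_iff.1 hcard
  have hp := part_blockMin (cyclePartition w τ) j
  rw [part_cyclePartition_eq_iff, ← cyc_eq_iff] at hp
  refine hm (hinj ?_ ?_ e) <;> simp [positions, e, hp]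

/-- The number of positions exceeds the number of letters and active cycles by an even number. -/
theorem exists_defect : ∃ δ, k = (letters w).card + (active w τ).card + 2 * δ := by
  have hle : (letters w).card + (active w τ).card ≤ k := by
    refine le_of_le_of_eq ?_ (sum_card_positions (w := w) (τ := τ))
    rw [← h.card_letters, Finset.card_eq_sum_ones, ← Finset.sum_add_distrib]
    exact Finset.sum_le_sum fun c hc => h.card_lt_positions hc
  -- Fixed points of `τ` that occur in the word contribute `2` each and do not affect the parity.
  have hsum : (letters w).card + (active w τ).card =
      ∑ c ∈ (active w τ).filter (fun c => c.card ≠ 1), (c.card + 1) +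
        2 * ((active w τ).filter (fun c => ¬ c.card ≠ 1)).card := by
    rw [← h.card_letters, Finset.card_eq_sum_ones, ← Finset.sum_add_distrib,
      ← Finset.sum_filter_add_sum_filter_not (active w τ) (fun c => c.card ≠ 1)]
    congr 1
    rw [Finset.card_eq_sum_ones, Finset.mul_sum]
    refine Finset.sum_congr rfl fun c hc => ?_
    have := (Finset.mem_filter.1 hc).2
    omega
  have hcyc : (active w τ).filter (fun c => c.card ≠ 1) =
      (cycles τ).filter fun c => c.card ≠ 1 := by
    ext c
    simp only [Finset.mem_filter, active, cycles_eq_image, Finset.mem_image, Finset.mem_univ,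
      true_and, and_congr_left_iff]
    intro hc
    constructor
    · rintro ⟨j, rfl⟩; exact ⟨_, rfl⟩
    · rintro ⟨i, rfl⟩
      by_contra hcon
      push Not at hcon
      exact apply_ne_of_card_cyc hc (h.apply_of_notMem i fun j e => hcon j (by rw [e]))
  have hs := h.sign_eq
  rw [sign_eq_sum_cycles, ← hcyc] at hs
  have hpar : (-1 : ℤˣ) ^ ((letters w).card + (active w τ).card) = (-1) ^ k := by
    rw [hsum, pow_add, hs, pow_mul]; simp
  obtain ⟨r, hr⟩ := Nat.exists_eq_add_of_le hle
  have hpow : (-1 : ℤˣ) ^ k = (-1) ^ ((letters w).card + (active w τ).card) * (-1) ^ r := by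
    rw [← pow_add, ← hr]
  rw [hpow, left_eq_mul, neg_one_pow_eq_one_iff_even (by decide)] at hpar
  obtain ⟨δ, hδ⟩ := hpar
  exact ⟨δ, by omega⟩

/-- If the defect vanishes, then the word comes from a noncrossing partition. -/
theorem fits_of_card_eq (hk : k = (letters w).card + (active w τ).card) :
    NoSingletons (cyclePartition w τ) ∧ Fits (cyclePartition w τ) w ∧
      IsNonCrossing (cyclePartition w τ) := by
  set π := cyclePartition w τ with hπ
  -- Defect zero forces equality in each of the inequalities of `card_lt_positions`, as their sums
  -- agree.
  have hcard : ∀ j, (positions w τ (cyc τ (w j))).card = (cyc τ (w j)).card + 1 := by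
    have hsum : ∑ c ∈ active w τ, (c.card + 1) = ∑ c ∈ active w τ, (positions w τ c).card := by
      rw [sum_card_positions, Finset.sum_add_distrib, h.card_letters, ← Finset.card_eq_sum_ones,
        ← hk]
    intro j
    exact ((Finset.sum_eq_sum_iff_of_le fun c hc => h.card_lt_positions hc).1 hsum _
      (Finset.mem_image_of_mem _ (Finset.mem_univ j))).symm
  have hs : NoSingletons π := by
    intro B hB e
    obtain ⟨j, hj⟩ := π.nonempty_of_mem_parts hB
    rw [← π.part_eq_of_mem hB hj, hπ, part_cyclePartition, hcard] at e
    have := Finset.card_pos.2 ⟨_, self_mem_cyc (τ := τ) (w j)⟩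
    omega
  have hpart : ∀ {i j : Fin k}, w i = w j → π.part i = π.part j := by
    intro i j e
    rw [hπ, part_cyclePartition_eq_iff, e]
  -- a position whose letter occurs elsewhere is the only obstruction to injectivity
  have hinj : ∀ a b : Fin k, b ≠ a → w b = w a → ∀ i j, π.part i = π.part a → i ≠ a → j ≠ a →
      w i = w j → i = j := by
    intro a b hba e i j hi hia hja hij
    have himg : ((positions w τ (cyc τ (w a))).erase a).image w = cyc τ (w a) := by
      refine Eq.trans ?_ (h.image_positions a)
      refine subset_antisymm (Finset.image_subset_image (Finset.erase_subset _ _)) ?_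
      intro x hx
      obtain ⟨m, hm, rfl⟩ := Finset.mem_image.1 hx
      by_cases hma : m = a
      · exact Finset.mem_image.2 ⟨b, Finset.mem_erase.2 ⟨hba, by simp [positions, e]⟩,
          by rw [e, hma]⟩
      · exact Finset.mem_image_of_mem _ (Finset.mem_erase.2 ⟨hma, hm⟩)
    have hc : ((positions w τ (cyc τ (w a))).erase a).card = (cyc τ (w a)).card := by
      rw [Finset.card_erase_of_mem (by simp [positions]), hcard]
      rfl
    conv_rhs at hc => rw [← himg]
    have hI := Finset.card_image_iff.1 hc.symm
    have hmem : ∀ m, m ≠ a → π.part m = π.part a →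
        m ∈ (((positions w τ (cyc τ (w a))).erase a : Finset (Fin k)) : Set (Fin k)) := by
      intro m hm hp
      rw [hπ, part_cyclePartition_eq_iff, ← cyc_eq_iff] at hp
      simp [positions, hm, hp]
    exact hI (hmem i hia hi) (hmem j hja ((hpart hij).symm.trans hi)) hij
  have hminmax : ∀ i, w (blockMin π i) = w (blockMax π i) := by
    intro i
    obtain ⟨m, hm, e⟩ := (h.exists_ne_of_extreme i).1
    obtain ⟨m', hm', e'⟩ := (h.exists_ne_of_extreme i).2
    -- `m` carries the same letter as the first position. If `m` were not the last one, deleting the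
    -- last position, whose letter also recurs, would leave a repetition, although the remaining
    -- positions are in bijection with the cycle.
    by_cases hmm : m = blockMax π i
    · rw [← hmm]; exact e.symm
    · refine absurd (hinj _ m' hm' e' m _ ?_ hmm (hs.blockMin_lt i).ne e) hm
      rw [hpart e, part_blockMin, part_blockMax]
  have hnonmax : ∀ i j, i ≠ blockMax π i → j ≠ blockMax π j → w i = w j → i = j := by
    intro i j hi hj e
    obtain ⟨m', hm', e'⟩ := (h.exists_ne_of_extreme i).2
    refine hinj _ m' hm' e' i j (part_blockMax π i).symm hi ?_ e
    exact (blockMax_congr (hpart e)) ▸ hj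
  have hwrep : ∀ i, w (rep π i) = w i := by
    intro i
    by_cases hi : i = blockMax π i
    · rw [hi, rep_blockMax, hminmax]
    · rw [rep_of_ne hi]
  have hrepne : ∀ i, rep π i ≠ blockMax π (rep π i) := by
    intro i
    by_cases hi : i = blockMax π i
    · have : rep π i = blockMin π i := if_pos hi
      rw [this, blockMax_congr (part_blockMin π i)]
      exact (hs.blockMin_lt i).ne
    · rwa [rep_of_ne hi]
  have hfit : Fits π w := by
    intro i j
    constructor
    · intro e
      exact hnonmax _ _ (hrepne i) (hrepne j) (by rw [hwrep, hwrep, e])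
    · intro e
      rw [← hwrep i, e, hwrep]
  exact ⟨hs, hfit, hfit.isNonCrossing hs h fun i j => part_cyclePartition_eq_iff.symm⟩

end Evaluates

/-! ### Expansion into words, and centrality -/

theorem sum_pow_eq_sum_words {R ι : Type*} [Semiring R] [Fintype ι] (f : ι → R) (k : ℕ) :
    (∑ z, f z) ^ k = ∑ W : Fin k → ι, (List.ofFn fun j => f (W j)).prod := by
  induction k with
  | zero => simp
  | succ k ih =>
    rw [pow_succ', ih, Finset.sum_mul_sum, ← Finset.sum_product',
      ← (Fin.consEquiv fun _ : Fin (k + 1) => ι).sum_comp]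
    refine Finset.sum_congr rfl fun p _ => ?_
    simp [Fin.consEquiv, List.ofFn_succ]

section Words

variable {T : Type*} [CommGroup T] {n k : ℕ}

/-- The summand `(x⁻¹, (i)) (x, (n+1)) (i n+1)` of the Jucys--Murphy element. -/
def jmTerm (z : Fin n × T) : Wreath T (n + 1) :=
  atPos z.2⁻¹ z.1.castSucc * atPos z.2 (Fin.last n) * transp T z.1.castSucc (Fin.last n)

theorem jmTerm_left (z : Fin n × T) :
    (jmTerm z).left = Pi.mulSingle z.1.castSucc z.2⁻¹ * Pi.mulSingle (Fin.last n) z.2 := by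
  simp [jmTerm, atPos, transp]

theorem jmTerm_right (z : Fin n × T) :
    (jmTerm z).right = Equiv.swap z.1.castSucc (Fin.last n) := by
  simp [jmTerm, atPos, transp]

/-- The product of the summands of the Jucys--Murphy element along a word, times `(y, (n+1))`. -/
def evalWord (y : T) (W : Fin k → Fin n × T) : Wreath T (n + 1) :=
  (List.ofFn fun j => jmTerm (W j)).prod * atPos y (Fin.last n)

theorem jm_pow_mul [Fintype T] (k n : ℕ) (y : T) :
    jm T n ^ k * MonoidAlgebra.of ℂ _ (atPos y (Fin.last n)) =
      ∑ W : Fin k → Fin n × T, MonoidAlgebra.of ℂ _ (evalWord y W) := by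
  have : jm T n = ∑ z : Fin n × T, MonoidAlgebra.of ℂ (Wreath T (n + 1)) (jmTerm z) := by
    rw [jm, Fintype.sum_prod_type]
    rfl
  rw [this, sum_pow_eq_sum_words, Finset.sum_mul]
  refine Finset.sum_congr rfl fun W _ => ?_
  rw [evalWord, map_mul, map_list_prod, List.map_ofFn]
  rfl

theorem incl_left_castSucc (h : Wreath T n) (i : Fin n) : (incl T n h).left i.castSucc = h.left i := by
  change (Fin.snoc (α := fun _ => T) h.left 1 : Fin (n + 1) → T) i.castSucc = _
  rw [Fin.snoc_castSucc]

theorem incl_left_last (h : Wreath T n) : (incl T n h).left (Fin.last n) = 1 := by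
  change (Fin.snoc (α := fun _ => T) h.left 1 : Fin (n + 1) → T) (Fin.last n) = _
  rw [Fin.snoc_last]

theorem incl_right (h : Wreath T n) : (incl T n h).right = extendPerm n h.right := rfl

theorem mul_left_apply (g h : Wreath T n) (i : Fin n) :
    (g * h).left i = g.left i * h.left (g.right⁻¹ i) := rfl

theorem mem_range_incl_iff (g : Wreath T (n + 1)) :
    g ∈ Set.range (incl T n) ↔ g.right (Fin.last n) = Fin.last n ∧ g.left (Fin.last n) = 1 := by
  constructor
  · rintro ⟨h, rfl⟩
    exact ⟨by rw [incl_right, extendPerm_last], incl_left_last h⟩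
  · rintro ⟨h1, h2⟩
    obtain ⟨τ, hτ⟩ := exists_extendPerm_eq _ h1
    refine ⟨⟨fun i => g.left i.castSucc, τ⟩, SemidirectProduct.ext ?_ hτ⟩
    funext i
    refine Fin.lastCases ?_ (fun j => ?_) i
    · rw [incl_left_last, h2]
    · rw [incl_left_castSucc]

/-- The action of `𝔖_n(T)` on the summands of the Jucys--Murphy element by conjugation. -/
def letterEquiv (h : Wreath T n) : Fin n × T ≃ Fin n × T where
  toFun z := (h.right z.1, z.2 * (h.left (h.right z.1))⁻¹)
  invFun z := (h.right⁻¹ z.1, z.2 * h.left z.1)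
  left_inv z := by simp
  right_inv z := by simp

theorem incl_mul_jmTerm (h : Wreath T n) (z : Fin n × T) :
    incl T n h * jmTerm z = jmTerm (letterEquiv h z) * incl T n h := by
  obtain ⟨i, x⟩ := z
  have hne : ∀ j : Fin n, j.castSucc ≠ Fin.last n := fun j => (Fin.castSucc_lt_last j).ne
  refine SemidirectProduct.ext ?_ ?_
  · funext m
    rw [mul_left_apply, mul_left_apply, jmTerm_left, jmTerm_left, jmTerm_right, Equiv.swap_inv,
      incl_right, ← map_inv]
    refine Fin.lastCases ?_ (fun j => ?_) m
    · rw [extendPerm_last, incl_left_last, Equiv.swap_apply_right]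
      simp [letterEquiv, incl_left_castSucc]
    · rw [extendPerm_castSucc, incl_left_castSucc]
      by_cases hj : j = h.right i
      · subst hj
        simp [letterEquiv, incl_left_last, mul_comm]
      · have h1 : h.right⁻¹ j ≠ i := fun e => hj (by rw [← e]; simp)
        rw [Equiv.swap_apply_of_ne_of_ne _ (hne j)]
        · simp [letterEquiv, incl_left_castSucc,
            Pi.mulSingle_eq_of_ne ((Fin.castSucc_injective n).ne hj)]
          exact Pi.mulSingle_eq_of_ne ((Fin.castSucc_injective n).ne h1) _
        · exact (Fin.castSucc_injective n).ne hj
  · change extendPerm n h.right * (jmTerm (i, x)).right =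
      (jmTerm (letterEquiv h (i, x))).right * extendPerm n h.right
    rw [jmTerm_right, jmTerm_right, Equiv.mul_swap_eq_swap_mul, extendPerm_castSucc,
      extendPerm_last]
    rfl

theorem incl_mul_atPos_last (h : Wreath T n) (y : T) :
    incl T n h * atPos y (Fin.last n) = atPos y (Fin.last n) * incl T n h := by
  refine SemidirectProduct.ext ?_ ?_
  · funext m
    rw [mul_left_apply, mul_left_apply, incl_right, ← map_inv]
    refine Fin.lastCases ?_ (fun j => ?_) m
    · rw [extendPerm_last, incl_left_last]
      simp [incl_left_last, atPos]
    · rw [extendPerm_castSucc]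
      simp [atPos]
  · simp [atPos]

theorem incl_mul_evalWord (h : Wreath T n) (y : T) (W : Fin k → Fin n × T) :
    incl T n h * evalWord y W = evalWord y (fun j => letterEquiv h (W j)) * incl T n h := by
  have key : ∀ l : List (Fin n × T), incl T n h * (l.map jmTerm).prod =
      (l.map fun z => jmTerm (letterEquiv h z)).prod * incl T n h := by
    intro l
    induction l with
    | nil => simp
    | cons z l ih =>
      rw [List.map_cons, List.prod_cons, ← mul_assoc, incl_mul_jmTerm, mul_assoc, ih,
        List.map_cons, List.prod_cons, mul_assoc]
  have := key (List.ofFn W)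
  simp only [List.map_ofFn] at this
  change incl T n h * ((List.ofFn (jmTerm ∘ W)).prod * atPos y (Fin.last n)) =
    (List.ofFn ((fun z => jmTerm (letterEquiv h z)) ∘ W)).prod * atPos y (Fin.last n) * incl T n h
  rw [← mul_assoc, this, mul_assoc, incl_mul_atPos_last, ← mul_assoc]

/-- The action of `𝔖_n(T)` on words. -/
def wordEquiv (k : ℕ) (h : Wreath T n) : (Fin k → Fin n × T) ≃ (Fin k → Fin n × T) :=
  Equiv.piCongrRight fun _ => letterEquiv h

theorem evalWord_wordEquiv (h : Wreath T n) (y : T) (W : Fin k → Fin n × T) :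
    evalWord y (wordEquiv k h W) = incl T n h * evalWord y W * incl T n h⁻¹ := by
  rw [incl_mul_evalWord, mul_assoc, ← map_mul, mul_inv_cancel, map_one, mul_one]
  rfl

variable [Fintype T]

theorem restrictE_sum {ι : Type*} (s : Finset ι) (f : ι → GroupAlg T (n + 1)) :
    restrictE (∑ a ∈ s, f a) = ∑ a ∈ s, restrictE (f a) := by
  unfold restrictE
  rw [Finset.sum_comm]
  refine Finset.sum_congr rfl fun h _ => ?_
  rw [MonoidAlgebra.coeff_sum, Finsupp.finsetSum_apply]
  exact map_sum (MonoidAlgebra.singleAddHom h) _ _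

theorem restrictE_conj (h : Wreath T n) (g : Wreath T (n + 1)) :
    restrictE (MonoidAlgebra.of ℂ _ (incl T n h * g * incl T n h⁻¹)) =
      MonoidAlgebra.of ℂ _ h * restrictE (MonoidAlgebra.of ℂ _ g) * MonoidAlgebra.of ℂ _ h⁻¹ := by
  by_cases hg : g ∈ Set.range (incl T n)
  · obtain ⟨g, rfl⟩ := hg
    rw [← map_mul, ← map_mul, restrictE_of_incl, restrictE_of_incl, map_mul, map_mul]
  · rw [restrictE_of_notMem g hg, restrictE_of_notMem, mul_zero, zero_mul]
    rintro ⟨a, ha⟩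
    refine hg ⟨h⁻¹ * a * h, ?_⟩
    rw [map_mul, map_mul, ha, map_inv]
    group

/-- Conjugation by an element of `𝔖_n(T)` permutes the summands of the Jucys–Murphy element, fixes
`(y, (n+1))` and commutes with the restriction, so it only reindexes the sum over words. -/
theorem restrictE_jm_mem_center (k n : ℕ) (y : T) :
    restrictE (jm T n ^ k * MonoidAlgebra.of ℂ _ (atPos y (Fin.last n))) ∈
      Subalgebra.center ℂ (GroupAlg T n) := by
  rw [jm_pow_mul, restrictE_sum]
  set X := ∑ W : Fin k → Fin n × T, restrictE (MonoidAlgebra.of ℂ _ (evalWord y W)) with hX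
  have hconj : ∀ h : Wreath T n, MonoidAlgebra.of ℂ _ h * X = X * MonoidAlgebra.of ℂ _ h := by
    intro h
    have : MonoidAlgebra.of ℂ _ h * X * MonoidAlgebra.of ℂ _ h⁻¹ = X := by
      conv_rhs => rw [hX, ← (wordEquiv k h).sum_comp]
      rw [hX, Finset.mul_sum, Finset.sum_mul]
      exact Finset.sum_congr rfl fun W _ => by rw [evalWord_wordEquiv, restrictE_conj]
    conv_rhs => rw [← this]
    rw [mul_assoc, ← map_mul, inv_mul_cancel, map_one, mul_one]
  rw [Subalgebra.mem_center_iff]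
  intro f
  induction f using MonoidAlgebra.induction_on with
  | of g => exact hconj g
  | add f g hf hg => rw [add_mul, mul_add, hf, hg]
  | smul r f hf => rw [smul_mul_assoc, mul_smul_comm, hf]

end Words

/-! ### Coordinates along cycles -/

section CycleIndex

variable {n : ℕ} (τ : Equiv.Perm (Fin n))

/-- A distinguished element of the cycle of `i`. -/
noncomputable def root (i : Fin n) : Fin n := (cyc τ i).min' ⟨i, self_mem_cyc i⟩

variable {τ}

theorem sameCycle_root (i : Fin n) : τ.SameCycle i (root τ i) := mem_cyc.1 (Finset.min'_mem _ _)

theorem root_congr {i j : Fin n} (h : cyc τ i = cyc τ j) : root τ i = root τ j := by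
  simp only [root, h]

theorem cyc_root (i : Fin n) : cyc τ (root τ i) = cyc τ i := cyc_eq_iff.2 (sameCycle_root i).symm

theorem cyc_mem_cycles (i : Fin n) : cyc τ i ∈ cycles τ :=
  Finset.mem_image_of_mem _ (Finset.mem_univ i)

theorem cyc_apply (i : Fin n) : cyc τ (τ i) = cyc τ i :=
  cyc_eq_iff.2 (Equiv.Perm.sameCycle_apply_left.2 (Equiv.Perm.SameCycle.refl _ _))

theorem cyc_eq_image_iterate (r : Fin n) :
    cyc τ r = (Finset.range (Function.minimalPeriod τ r)).image fun a => τ^[a] r := by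
  ext i
  simp only [mem_cyc, Finset.mem_image, Finset.mem_range]
  constructor
  · intro h
    obtain ⟨a, ha⟩ := h.exists_nat_pow_eq
    refine ⟨a % Function.minimalPeriod τ r, Nat.mod_lt _ ?_, ?_⟩
    · exact Function.minimalPeriod_pos_of_mem_periodicPts
        (τ.injective.mem_periodicPts r)
    · rw [Function.iterate_mod_minimalPeriod_eq, Equiv.Perm.iterate_eq_pow, ha]
  · rintro ⟨a, -, rfl⟩
    exact ⟨a, by rw [Equiv.Perm.iterate_eq_pow, zpow_natCast]⟩

theorem minimalPeriod_eq_card_cyc (r : Fin n) : Function.minimalPeriod τ r = (cyc τ r).card := by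
  rw [cyc_eq_image_iterate, Finset.card_image_of_injOn, Finset.card_range]
  intro a ha b hb e
  exact Function.iterate_injOn_Iio_minimalPeriod (by simpa using ha) (by simpa using hb) e

theorem prod_cyc_eq_prod_range {M : Type*} [CommMonoid M] (f : Fin n → M) (r : Fin n) :
    ∏ i ∈ cyc τ r, f i = ∏ a ∈ Finset.range (Function.minimalPeriod τ r), f (τ^[a] r) := by
  rw [cyc_eq_image_iterate, Finset.prod_image]
  intro a ha b hb e
  exact Function.iterate_injOn_Iio_minimalPeriod (by simpa using ha) (by simpa using hb) e

theorem exists_index (i : Fin n) :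
    ∃ a < Function.minimalPeriod τ (root τ i), τ^[a] (root τ i) = i := by
  have : i ∈ cyc τ (root τ i) := by rw [cyc_root]; exact self_mem_cyc i
  rw [cyc_eq_image_iterate] at this
  simpa using this

variable (τ) in
/-- The position of `i` in its cycle, counted from the root. -/
noncomputable def index (i : Fin n) : ℕ := (exists_index (τ := τ) i).choose

theorem index_lt (i : Fin n) : index τ i < Function.minimalPeriod τ (root τ i) :=
  (exists_index i).choose_spec.1

theorem iterate_index (i : Fin n) : τ^[index τ i] (root τ i) = i :=
  (exists_index i).choose_spec.2

theorem index_apply (i : Fin n) :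
    index τ (τ i) = index τ i + 1 ∨
      (index τ (τ i) = 0 ∧ index τ i + 1 = Function.minimalPeriod τ (root τ i)) := by
  have hr : root τ (τ i) = root τ i := root_congr (cyc_apply i)
  have h1 := index_lt (τ := τ) i
  have h2 := index_lt (τ := τ) (τ i)
  have e : τ^[index τ (τ i)] (root τ i) = τ^[index τ i + 1] (root τ i) := by
    rw [Function.iterate_succ_apply', iterate_index, ← hr, iterate_index]
  rw [hr] at h2
  rcases (Nat.succ_le_of_lt h1).lt_or_eq with h | h
  · exact Or.inl (Function.iterate_injOn_Iio_minimalPeriod h2 h e)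
  · refine Or.inr ⟨Function.iterate_injOn_Iio_minimalPeriod h2 (Nat.zero_lt_of_lt h1) ?_, h⟩
    rw [show index τ i + 1 = _ from h, Function.iterate_minimalPeriod] at e
    exact e

/-- A function on the letters with trivial product along every cycle is a coboundary. -/
theorem exists_coboundary {G : Type*} [CommGroup G] (f : Fin n → G)
    (hf : ∀ i, ∏ j ∈ cyc τ i, f j = 1) : ∃ s : Fin n → G, ∀ i, s (τ i) = f i * s i := by
  -- The product of `f` from the root up to, but excluding, `i`. The relation where the cycle
  -- returns to its root is the hypothesis on the full product.
  refine ⟨fun i => ∏ a ∈ Finset.range (index τ i), f (τ^[a] (root τ i)), fun i => ?_⟩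
  have hr : root τ (τ i) = root τ i := root_congr (cyc_apply i)
  have hstep : ∏ a ∈ Finset.range (index τ i + 1), f (τ^[a] (root τ i)) =
      f i * ∏ a ∈ Finset.range (index τ i), f (τ^[a] (root τ i)) := by
    rw [Finset.prod_range_succ, iterate_index, mul_comm]
  simp only [hr]
  rw [← hstep]
  rcases index_apply (τ := τ) i with h | ⟨h, h'⟩
  · rw [h]
  · rw [h, h', ← prod_cyc_eq_prod_range, hf]
    rfl

/-- A bijection between the cycles of two permutations preserving the lengths is induced by a
conjugating permutation. -/
theorem exists_conj_of_cycles {τ' : Equiv.Perm (Fin n)} (φ : cycles τ ≃ cycles τ')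
    (hφ : ∀ c, (φ c).1.card = c.1.card) :
    ∃ θ : Equiv.Perm (Fin n), (∀ i, θ (τ i) = τ' (θ i)) ∧
      ∀ i (hi : cyc τ i ∈ cycles τ), cyc τ' (θ i) = φ ⟨cyc τ i, hi⟩ := by
  have hmem : ∀ i, cyc τ i ∈ cycles τ := cyc_mem_cycles
  have hφ' : ∀ i, ∃ r, cyc τ' r = φ ⟨cyc τ i, hmem i⟩ := fun i => by
    obtain ⟨r, -, hr⟩ := Finset.mem_image.1
      (show _ ∈ Finset.univ.image (cyc τ') from (φ ⟨cyc τ i, hmem i⟩).2)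
    exact ⟨r, hr⟩
  choose r₀ hr₀ using hφ'
  -- The choice `r₀` may differ within a cycle; taking the root makes the base point depend on the
  -- cycle only.
  let r : Fin n → Fin n := fun i => root τ' (r₀ i)
  have hr : ∀ i, cyc τ' (r i) = φ ⟨cyc τ i, hmem i⟩ := fun i => (cyc_root _).trans (hr₀ i)
  have hr_congr : ∀ i j, cyc τ i = cyc τ j → r i = r j := by
    intro i j h
    refine root_congr ?_
    rw [hr₀, hr₀]
    simp only [h]
  have hper : ∀ i, Function.minimalPeriod τ' (r i) = Function.minimalPeriod τ (root τ i) := by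
    intro i
    rw [minimalPeriod_eq_card_cyc, minimalPeriod_eq_card_cyc, hr, hφ, cyc_root]
  -- The `a`th letter after the root of a cycle goes to the `a`th letter after the base point of the
  -- matching cycle. Equal periods make this injective.
  let θ₀ : Fin n → Fin n := fun i => τ'^[index τ i] (r i)
  have hcyc : ∀ i, cyc τ' (θ₀ i) = φ ⟨cyc τ i, hmem i⟩ := by
    intro i
    rw [← hr, cyc_eq_iff]
    exact Equiv.Perm.SameCycle.symm ⟨index τ i, by
      rw [zpow_natCast, ← Equiv.Perm.iterate_eq_pow]⟩
  have hinj : Function.Injective θ₀ := by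
    intro i j h
    have hc : cyc τ i = cyc τ j := by
      have := (hcyc i).symm.trans ((congrArg (cyc τ') h).trans (hcyc j))
      simpa using φ.injective (Subtype.ext this)
    have hroot := root_congr hc
    have hidx : index τ i = index τ j := by
      refine Function.iterate_injOn_Iio_minimalPeriod (f := τ') (x := r i) ?_ ?_ ?_
      · rw [Set.mem_Iio, hper]; exact index_lt i
      · rw [Set.mem_Iio, hper, hroot]; exact index_lt j
      · exact h.trans (by rw [hr_congr i j hc])
    rw [← iterate_index (τ := τ) i, hidx, hroot, iterate_index]
  refine ⟨Equiv.ofBijective θ₀ (Finite.injective_iff_bijective.1 hinj), fun i => ?_,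
    fun i _ => hcyc i⟩
  change τ'^[index τ (τ i)] (r (τ i)) = τ' (τ'^[index τ i] (r i))
  rw [hr_congr _ _ (cyc_apply i), ← Function.iterate_succ_apply' τ']
  rcases index_apply (τ := τ) i with h | ⟨h, h'⟩
  · rw [h]
  · rw [h, Nat.succ_eq_add_one, h', ← hper, Function.iterate_minimalPeriod]
    rfl

end CycleIndex

/-! ### The type classifies conjugacy classes -/

section Conjugacy

variable {T : Type*} [CommGroup T] {n : ℕ}

theorem cyc_image_of_conj {τ τ' θ : Equiv.Perm (Fin n)} (h : ∀ i, θ (τ i) = τ' (θ i)) (i : Fin n) :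
    (cyc τ i).image θ = cyc τ' (θ i) := by
  have hτ' : τ' = θ * τ * θ⁻¹ := by
    ext j
    simp [h]
  ext j
  simp only [Finset.mem_image, mem_cyc]
  rw [hτ', Equiv.Perm.sameCycle_conj]
  simp only [Equiv.Perm.inv_def, Equiv.symm_apply_apply]
  constructor
  · rintro ⟨a, ha, rfl⟩
    simpa using ha
  · intro hj
    exact ⟨_, hj, by simp⟩

theorem prod_cyc_apply {M : Type*} [CommMonoid M] {τ : Equiv.Perm (Fin n)} (f : Fin n → M)
    (i : Fin n) : ∏ j ∈ cyc τ i, f (τ j) = ∏ j ∈ cyc τ i, f j := by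
  have : (cyc τ i).image τ = cyc τ i := by
    rw [cyc_image_of_conj (τ' := τ) (θ := τ) (fun _ => rfl), cyc_apply]
  conv_rhs => rw [← this]
  rw [Finset.prod_image fun a _ b _ e => τ.injective e]

theorem type_conj (h g : Wreath T n) : type (h * g * h⁻¹) = type g := by
  obtain ⟨g', hg'⟩ : ∃ g', g' = h * g * h⁻¹ := ⟨_, rfl⟩
  rw [← hg']
  have hgh : g' * h = h * g := by rw [hg']; group
  have hright : ∀ i, h.right (g.right i) = g'.right (h.right i) := fun i => by
    have := congrArg SemidirectProduct.right hgh
    exact (DFunLike.congr_fun this i).symm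
  have hleft : ∀ i, g'.left (h.right (g.right i)) * h.left (h.right i) =
      h.left (h.right (g.right i)) * g.left (g.right i) := fun i => by
    have := congrFun (congrArg SemidirectProduct.left hgh) (h.right (g.right i))
    rw [mul_left_apply, mul_left_apply] at this
    rw [hright] at this ⊢
    simp only [Equiv.Perm.inv_def, Equiv.symm_apply_apply] at this
    rw [this, ← hright]
    simp
  have hcycles : cycles g'.right = (cycles g.right).image fun c => c.image h.right := by
    rw [cycles_eq_image, cycles_eq_image, Finset.image_image]
    ext c
    simp only [Finset.mem_image, Finset.mem_univ, true_and, Function.comp_apply,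
      cyc_image_of_conj hright]
    exact ⟨fun ⟨a, ha⟩ => ⟨h.right⁻¹ a, by simpa using ha⟩, fun ⟨a, ha⟩ => ⟨_, ha⟩⟩
  have hprod : ∀ c ∈ cycles g.right, ∏ i ∈ c.image h.right, g'.left i = ∏ i ∈ c, g.left i := by
    intro c hc
    simp only [cycles_eq_image, Finset.mem_image, Finset.mem_univ, true_and] at hc
    obtain ⟨i, rfl⟩ := hc
    rw [Finset.prod_image fun a _ b _ e => h.right.injective e,
      ← prod_cyc_apply (τ := g.right) (fun j => g'.left (h.right j)),
      ← prod_cyc_apply (τ := g.right) g.left]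
    -- Multiplying the relation `hleft` around a cycle, the entries of `h` occur once on each side
    -- and cancel.
    have e := Finset.prod_congr (rfl : cyc g.right i = cyc g.right i) fun j _ => hleft j
    rw [Finset.prod_mul_distrib, Finset.prod_mul_distrib,
      prod_cyc_apply (τ := g.right) (fun j => h.left (h.right j)), mul_comm] at e
    exact mul_left_cancel e
  have hinj : Function.Injective fun c : Finset (Fin n) => c.image h.right :=
    Finset.image_injective h.right.injective
  funext x
  unfold type
  rw [hcycles, Finset.filter_image, Finset.image_val_of_injOn hinj.injOn, Multiset.map_map]
  have hfilter : (cycles g.right).filter (fun c => ∏ i ∈ c.image h.right, g'.left i = x) =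
      (cycles g.right).filter fun c => ∏ i ∈ c, g.left i = x :=
    Finset.filter_congr fun c hc => by rw [hprod c hc]
  rw [hfilter]
  exact Multiset.map_congr rfl fun c _ => Finset.card_image_of_injective _ h.right.injective

theorem card_filter_eq_count_type (g : Wreath T n) (x : T) (m : ℕ) :
    ((cycles g.right).filter fun c => ∏ i ∈ c, g.left i = x ∧ c.card = m).card =
      (type g x).count m := by
  rw [type, Multiset.count_map, ← Finset.filter_filter]
  simp only [eq_comm (a := m)]
  rfl

/-- Equal types allow the cycles to be matched with the same length and the same product. A
permutation `θ` realizes the matching; the quotient of the entries then has trivial product along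
every cycle, hence is a coboundary, which supplies the `T`-part of the conjugator. -/
theorem exists_conj_of_type_eq {g g' : Wreath T n} (h : type g = type g') :
    ∃ a : Wreath T n, g' = a * g * a⁻¹ := by
  let F : (g : Wreath T n) → cycles g.right → T × ℕ := fun g c => (∏ i ∈ c.1, g.left i, c.1.card)
  have hcard : ∀ (g : Wreath T n) (p : T × ℕ),
      Fintype.card {c // F g c = p} = (type g p.1).count p.2 := by
    intro g p
    rw [← card_filter_eq_count_type, Fintype.card_subtype, Finset.univ_eq_attach]
    refine Finset.card_bij (fun c _ => c.1) ?_ ?_ ?_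
    · intro c hc
      have := (Finset.mem_filter.1 hc).2
      simp only [F, Prod.ext_iff] at this
      exact Finset.mem_filter.2 ⟨c.2, this⟩
    · intro a _ b _ e
      exact Subtype.ext e
    · intro c hc
      obtain ⟨h1, h2⟩ := Finset.mem_filter.1 hc
      exact ⟨⟨c, h1⟩, by simpa [F, Prod.ext_iff] using h2, rfl⟩
  have e : ∀ p, Nonempty ({c // F g c = p} ≃ {c // F g' c = p}) := fun p =>
    Fintype.card_eq.1 (by rw [hcard, hcard, h])
  let φ : cycles g.right ≃ cycles g'.right := Equiv.ofFiberEquiv fun p => (e p).some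
  have hφ : ∀ c, F g' (φ c) = F g c := fun c => Equiv.ofFiberEquiv_map _ c
  obtain ⟨θ, hθ, hθc⟩ := exists_conj_of_cycles φ fun c => (Prod.ext_iff.1 (hφ c)).2
  obtain ⟨S, hS⟩ := exists_coboundary (τ := g.right)
    (fun i => g'.left (θ (g.right i)) * (g.left (g.right i))⁻¹) (by
      intro i
      rw [prod_cyc_apply (τ := g.right) (fun j => g'.left (θ j) * (g.left j)⁻¹),
        Finset.prod_mul_distrib, Finset.prod_inv_distrib, mul_inv_eq_one]
      have := (Prod.ext_iff.1 (hφ ⟨cyc g.right i, cyc_mem_cycles i⟩)).1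
      simp only [F] at this
      rw [← this, ← hθc i, ← cyc_image_of_conj hθ,
        Finset.prod_image fun a _ b _ e => θ.injective e])
  refine ⟨⟨fun m => S (θ⁻¹ m), θ⟩, ?_⟩
  rw [eq_mul_inv_iff_mul_eq]
  refine SemidirectProduct.ext ?_ ?_
  · funext m
    rw [mul_left_apply, mul_left_apply]
    obtain ⟨i, rfl⟩ : ∃ i, m = θ (g.right i) := ⟨g.right⁻¹ (θ⁻¹ m), by simp⟩
    have h1 : g'.right⁻¹ (θ (g.right i)) = θ i := by rw [hθ]; simp
    rw [h1]
    simp only [Equiv.Perm.inv_def, Equiv.symm_apply_apply, hS]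
    rw [mul_right_comm, inv_mul_cancel_right]
  · ext i
    change (g'.right (θ i) : ℕ) = θ (g.right i)
    rw [hθ]

/-- A family of elements of a single type whose distribution is invariant under conjugation sums
to a multiple of the normalized class indicator. -/
theorem sum_of_eq_card_smul_normIndicator [Fintype T] {ι : Type*} (s : Finset ι)
    (φ : ι → Wreath T n) (ρ : T → Multiset ℕ) (hρ : ∀ a ∈ s, type (φ a) = ρ)
    (α : Wreath T n → ι ≃ ι) (hα : ∀ h, ∀ a ∈ s, α h a ∈ s)
    (hφ : ∀ h, ∀ a ∈ s, φ (α h a) = h * φ a * h⁻¹) :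
    ∑ a ∈ s, MonoidAlgebra.of ℂ _ (φ a) = (s.card : ℂ) • normIndicator n ρ := by
  rcases s.eq_empty_or_nonempty with rfl | ⟨a₀, ha₀⟩
  · simp
  have hmaps : ∀ a ∈ s, φ a ∈ conjClass n ρ := fun a ha => by simp [conjClass, hρ a ha]
  -- Conjugation embeds each fibre of `φ` into the fibre over the conjugate element; using inverses
  -- too, all fibres over the class have the same size.
  have hle : ∀ g h, (s.filter fun a => φ a = g).card ≤
      (s.filter fun a => φ a = h * g * h⁻¹).card := by
    intro g h
    refine Finset.card_le_card_of_injOn (α h) ?_ (α h).injective.injOn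
    intro a ha
    obtain ⟨h1, h2⟩ := Finset.mem_filter.1 (Finset.mem_coe.1 ha)
    exact Finset.mem_coe.2 (Finset.mem_filter.2 ⟨hα h a h1, by rw [hφ h a h1, h2]⟩)
  have hconst : ∀ g ∈ conjClass n ρ, (s.filter fun a => φ a = g).card =
      (s.filter fun a => φ a = φ a₀).card := by
    intro g hg
    have ht : type g = type (φ a₀) := by
      rw [hρ a₀ ha₀]; simpa [conjClass] using hg
    obtain ⟨h, hh⟩ := exists_conj_of_type_eq ht
    refine le_antisymm (hh ▸ hle g h) ?_
    have e : g = h⁻¹ * φ a₀ * h⁻¹⁻¹ := by rw [hh]; group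
    conv_rhs => rw [e]
    exact hle _ _
  have hcard : s.card = (conjClass n ρ).card * (s.filter fun a => φ a = φ a₀).card := by
    rw [Finset.card_eq_sum_card_fiberwise hmaps, Finset.sum_congr rfl hconst, Finset.sum_const,
      smul_eq_mul]
  have hne : ((conjClass n ρ).card : ℂ) ≠ 0 :=
    Nat.cast_ne_zero.2 (Finset.card_ne_zero_of_mem (hmaps a₀ ha₀))
  rw [← Finset.sum_fiberwise_of_maps_to hmaps, normIndicator, smul_smul, hcard, Nat.cast_mul,
    mul_right_comm, mul_inv_cancel₀ hne, one_mul, Finset.smul_sum]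
  refine Finset.sum_congr rfl fun g hg => ?_
  rw [← hconst g hg, Finset.sum_congr rfl (g := fun _ => MonoidAlgebra.of ℂ (Wreath T n) g)
    (fun a ha => by rw [(Finset.mem_filter.1 ha).2]), Finset.sum_const, Nat.cast_smul_eq_nsmul]

end Conjugacy

/-! ### The `T`-part of the product of a word -/

section Labels

variable {T : Type*} [CommGroup T] {n k : ℕ}

/-- The `T`-part of the product of the summands of the Jucys--Murphy element with letters `w`
and labels `x`. -/
def baseLeft (w : Fin k → Fin n) : (Fin k → T) →* (Fin (n + 1) → T) where
  toFun x := ∏ j : Fin k, (Pi.mulSingle (point w j) (x j) * (Pi.mulSingle (point w (j + 1)) (x j))⁻¹)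
  map_one' := by simp
  map_mul' x x' := by
    rw [← Finset.prod_mul_distrib]
    refine Finset.prod_congr rfl fun j _ => ?_
    rw [Pi.mul_apply, Pi.mulSingle_mul, Pi.mulSingle_mul, mul_inv, mul_mul_mul_comm]

theorem baseLeft_apply (w : Fin k → Fin n) (x : Fin k → T) : baseLeft w x =
    ∏ j : Fin k, (Pi.mulSingle (point w j) (x j) * (Pi.mulSingle (point w (j + 1)) (x j))⁻¹) := rfl

theorem mulSingle_perm (σ : Equiv.Perm (Fin (n + 1))) (a m : Fin (n + 1)) (x : T) :
    (Pi.mulSingle a x : Fin (n + 1) → T) (σ⁻¹ m) = (Pi.mulSingle (σ a) x : Fin (n + 1) → T) m := by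
  by_cases h : m = σ a
  · subst h; simp
  · rw [Pi.mulSingle_eq_of_ne h, Pi.mulSingle_eq_of_ne]
    intro e
    exact h (by rw [← e]; simp)

/-- The preceding product moves the entries of the `j`th factor: `x` goes from the last letter to
`point w j`, and `x⁻¹` from `w j` to `point w (j + 1)`. -/
theorem take_prod (W : Fin k → Fin n × T) (j : ℕ) (hj : j ≤ k) :
    (((List.ofFn fun i => jmTerm (W i)).take j).prod).right = pre (fun i => (W i).1) j ∧
    (((List.ofFn fun i => jmTerm (W i)).take j).prod).left =
      ∏ i : Fin j, (Pi.mulSingle (point (fun i => (W i).1) i) (W (Fin.castLE hj i)).2 *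
        (Pi.mulSingle (point (fun i => (W i).1) (i + 1)) (W (Fin.castLE hj i)).2)⁻¹) := by
  induction j with
  | zero => simp [pre]
  | succ j ih =>
    obtain ⟨h1, h2⟩ := ih (by omega)
    have hlen : j < (List.ofFn fun i => jmTerm (W i)).length := by simpa using hj
    rw [List.prod_take_succ _ _ hlen, List.getElem_ofFn]
    have hpre := pre_succ (fun i => (W i).1) ⟨j, hj⟩
    have hpt := point_succ (fun i => (W i).1) ⟨j, hj⟩
    simp only at hpre hpt
    constructor
    · rw [SemidirectProduct.mul_right, h1, jmTerm_right, hpre]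
    · funext m
      rw [mul_left_apply, h1, h2, Fin.prod_univ_castSucc, Pi.mul_apply, jmTerm_left, Pi.mul_apply,
        mulSingle_perm, mulSingle_perm, Pi.mul_apply, Pi.inv_apply]
      congr 1
      rw [mul_comm]
      congr 1
      rw [Pi.mulSingle_inv, Pi.inv_apply]
      simp only [Fin.val_last]
      rw [hpt]
      rfl

theorem evalWord_right (y : T) (W : Fin k → Fin n × T) :
    (evalWord y W).right = pre (fun i => (W i).1) k := by
  have := (take_prod W k le_rfl).1
  rw [List.take_of_length_le (by simp)] at this
  rw [evalWord, SemidirectProduct.mul_right, this]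
  simp [atPos]

theorem evalWord_left (y : T) (W : Fin k → Fin n × T) :
    (evalWord y W).left = baseLeft (fun i => (W i).1) (fun i => (W i).2) *
      Pi.mulSingle (point (fun i => (W i).1) k) y := by
  have h1 := (take_prod W k le_rfl).1
  have h2 := (take_prod W k le_rfl).2
  rw [List.take_of_length_le (by simp)] at h1 h2
  funext m
  rw [evalWord, mul_left_apply, h1, h2]
  simp only [atPos, SemidirectProduct.left_inl, mulSingle_perm]
  rfl

/-- Each label is inserted once together with its inverse. -/
theorem prod_baseLeft (w : Fin k → Fin n) (x : Fin k → T) : ∏ m, baseLeft w x m = 1 := by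
  simp only [baseLeft_apply, Finset.prod_apply, Pi.mul_apply, Pi.inv_apply]
  rw [Finset.prod_comm]
  refine Finset.prod_eq_one fun j _ => ?_
  rw [Finset.prod_mul_distrib, Finset.prod_inv_distrib, Fintype.prod_pi_mulSingle',
    Fintype.prod_pi_mulSingle', mul_inv_cancel]

theorem baseLeft_of_notMem (w : Fin k → Fin n) (x : Fin k → T) (i : Fin n) (hi : ∀ j, w j ≠ i) :
    baseLeft w x i.castSucc = 1 := by
  have key : ∀ j ≤ k, i.castSucc ≠ point w j := by
    intro j hj e
    rcases point_eq w j hj with h | ⟨m, -, h⟩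
    · exact (Fin.castSucc_lt_last i).ne (e.trans h)
    · exact hi m (Fin.castSucc_injective _ (e.trans h)).symm
  simp only [baseLeft_apply, Finset.prod_apply, Pi.mul_apply, Pi.inv_apply]
  refine Finset.prod_eq_one fun j _ => ?_
  rw [Pi.mulSingle_eq_of_ne (key _ j.2.le), Pi.mulSingle_eq_of_ne (key _ j.2), inv_one, mul_one]

/-- The labels `a` at all the positions after `m`. -/
theorem baseLeft_step (w : Fin k → Fin n) (m : Fin k) (a : T) :
    baseLeft w (fun j : Fin k => if m < j then a else 1) =
      Pi.mulSingle (point w (m + 1)) a / Pi.mulSingle (point w k) a := by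
  -- The `max` makes the sequence constant up to `m + 1`, so that the positions up to `m`, with
  -- label `1`, fit into the same telescoping product.
  let g : ℕ → Fin (n + 1) → T := fun j => Pi.mulSingle (point w (max j (m + 1))) a
  have h1 : baseLeft w (fun j : Fin k => if m < j then a else 1) =
      ∏ j ∈ Finset.range k, g j / g (j + 1) := by
    rw [Finset.prod_range, baseLeft_apply]
    refine Finset.prod_congr rfl fun j _ => ?_
    rw [← div_eq_mul_inv]
    by_cases h : m < j
    · have h' : (m : ℕ) < j := h
      simp only [g, if_pos h]
      rw [max_eq_left (by omega), max_eq_left (by omega)]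
    · have h' : (j : ℕ) ≤ m := not_lt.1 h
      simp only [g, if_neg h]
      rw [max_eq_right (by omega), max_eq_right (by omega)]
      simp
  rw [h1, Finset.prod_range_div']
  simp only [g]
  rw [max_eq_right (by omega), max_eq_left (by have := m.2; omega)]

/-- An element of `𝔖_n(T)` coming from a word. -/
def IsValue (y : T) (W : Fin k → Fin n × T) (g : Wreath T n) : Prop := incl T n g = evalWord y W

namespace IsValue

variable {y : T} {W : Fin k → Fin n × T} {g : Wreath T n} (h : IsValue y W g)
include h

theorem evaluates : Evaluates (fun i => (W i).1) g.right := by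
  rw [Evaluates, ← incl_right, h, evalWord_right]

theorem left_apply (i : Fin n) :
    g.left i = baseLeft (fun i => (W i).1) (fun i => (W i).2) i.castSucc := by
  rw [← incl_left_castSucc, h, evalWord_left, h.evaluates.point_length, Pi.mul_apply,
    Pi.mulSingle_eq_of_ne (Fin.castSucc_lt_last i).ne, mul_one]

theorem left_of_notMem (i : Fin n) (hi : ∀ j, (W j).1 ≠ i) : g.left i = 1 := by
  rw [h.left_apply, baseLeft_of_notMem _ _ _ hi]

theorem wordEquiv (a : Wreath T n) : IsValue y (wordEquiv k a W) (a * g * a⁻¹) := by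
  rw [IsValue, evalWord_wordEquiv, map_mul, map_mul, h]

end IsValue

/-- The entries of `baseLeft` multiply to `1`, so the one at the last letter is inverse to the
product of the others; the factor `(y, (n+1))` has to cancel it. -/
theorem exists_isValue_iff {y : T} {W : Fin k → Fin n × T} {τ : Equiv.Perm (Fin n)}
    (h : Evaluates (fun i => (W i).1) τ) : (∃ g, IsValue y W g) ↔
      ∏ i : Fin n, baseLeft (fun i => (W i).1) (fun i => (W i).2) i.castSucc = y := by
  have h0 := prod_baseLeft (fun i => (W i).1) (fun i => (W i).2)
  rw [Fin.prod_univ_castSucc] at h0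
  have h1 := mem_range_incl_iff (evalWord y W)
  rw [evalWord_right, evalWord_left, h.point_length, Pi.mul_apply, Pi.mulSingle_eq_same,
    and_iff_right (show pre (fun i => (W i).1) k (Fin.last n) = _ from h.point_length)] at h1
  refine h1.trans ?_
  rw [eq_inv_of_mul_eq_one_right h0, inv_mul_eq_one]

/-- The cycles of the product of a word are those of its letters and trivial ones. -/
theorem Evaluates.cycles_eq {w : Fin k → Fin n} {τ : Equiv.Perm (Fin n)} (h : Evaluates w τ) :
    cycles τ = active w τ ∪ (letters w)ᶜ.image fun i => {i} := by
  have hfix : ∀ i ∈ (letters w)ᶜ, cyc τ i = {i} := by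
    intro i hi
    refine cyc_eq_singleton (h.apply_of_notMem i fun j e => ?_)
    exact (Finset.mem_compl.1 hi) (Finset.mem_image.2 ⟨j, Finset.mem_univ j, e⟩)
  have hact : active w τ = (letters w).image (cyc τ) := by
    rw [letters, Finset.image_image]
    rfl
  rw [cycles_eq_image, ← Finset.image_congr (fun i hi => hfix i hi), hact, ← Finset.image_union]
  congr 1
  exact (Finset.union_compl _).symm

theorem disjoint_active (w : Fin k → Fin n) (τ : Equiv.Perm (Fin n)) :
    Disjoint (active w τ) ((letters w)ᶜ.image fun i => {i}) := by
  rw [Finset.disjoint_left]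
  intro c hc hc'
  simp only [active, letters, Finset.mem_image, Finset.mem_univ, true_and,
    Finset.mem_compl, not_exists] at hc hc'
  obtain ⟨j, rfl⟩ := hc
  obtain ⟨i, hi, e⟩ := hc'
  have := self_mem_cyc (τ := τ) (w j)
  rw [← e, Finset.mem_singleton] at this
  exact hi j this

theorem sum_map_filter_eq {α β γ : Type*} [Fintype β] (s : Finset α) (f : α → β) (g : α → γ) :
    ∑ x, (s.filter fun a => f a = x).val.map g = s.val.map g := by
  have key : ∀ s : Finset α, s.val.map g = ∑ a ∈ s, {g a} := by
    intro s
    have := Multiset.sum_map_singleton (s.val.map g)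
    rw [Multiset.map_map] at this
    exact this.symm
  simp only [key]
  exact Finset.sum_fiberwise s f _

theorem nontrivialCycles_eq [Fintype T] (g : Wreath T n) : nontrivialCycles g =
    ((cycles g.right).filter fun c => ¬ (c.card = 1 ∧ ∏ i ∈ c, g.left i = 1)).val.map
      Finset.card := by
  rw [← sum_map_filter_eq _ fun c => ∏ i ∈ c, g.left i, nontrivialCycles]
  refine Finset.sum_congr rfl fun x _ => ?_
  by_cases hx : x = 1
  · rw [if_pos hx, type, Multiset.filter_map, ← Finset.filter_val, Finset.filter_filter,
      Finset.filter_filter]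
    congr 2
    refine Finset.filter_congr fun c _ => ?_
    subst hx
    simp only [Function.comp_apply]
    tauto
  · rw [if_neg hx, type, Finset.filter_filter]
    congr 2
    refine Finset.filter_congr fun c _ => ⟨fun h => ⟨?_, h⟩, fun h => h.2⟩
    rintro ⟨-, h'⟩
    exact hx (h.symm.trans h')

end Labels

/-! ### The diagram attributed to a word -/

section Defect

variable {T : Type*} [CommGroup T] [Fintype T] {n k : ℕ}

/-- The diagram to which the value of a word with a given defect is attributed. -/
theorem IsValue.exists_diagram {y : T} {W : Fin k → Fin n × T} {g : Wreath T n}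
    (h : IsValue y W g) {δ : ℕ} (hδ : k = (letters fun i => (W i).1).card +
      (active (fun i => (W i).1) g.right).card + 2 * δ) :
    ∃ σ ∈ diagramsNoOnes k,
      (∃ j, nontrivialCycles g + Multiset.replicate j 1 = removeColumn σ) ∧
        (letters fun i => (W i).1).card + δ + len σ = k := by
  set w : Fin k → Fin n := fun i => (W i).1 with hw
  have hτ : Evaluates w g.right := h.evaluates
  set A := active w g.right with hA
  let P : Finset (Fin n) → Prop := fun c => c.card = 1 ∧ ∏ i ∈ c, g.left i = 1
  have hnt : nontrivialCycles g = (A.filter fun c => ¬ P c).val.map Finset.card := by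
    rw [nontrivialCycles_eq, hτ.cycles_eq, Finset.filter_union]
    congr 2
    rw [Finset.union_eq_left]
    intro c hc
    obtain ⟨hc1, hc2⟩ := Finset.mem_filter.1 hc
    obtain ⟨i, hi, rfl⟩ := Finset.mem_image.1 hc1
    refine absurd ⟨Finset.card_singleton i, ?_⟩ hc2
    rw [Finset.prod_singleton]
    exact h.left_of_notMem i fun j e =>
      (Finset.mem_compl.1 hi) (Finset.mem_image.2 ⟨j, Finset.mem_univ j, e⟩)
  have hpos : ∀ m ∈ nontrivialCycles g, 0 < m := by
    intro m hm
    rw [hnt] at hm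
    obtain ⟨c, hc, rfl⟩ := Multiset.mem_map.1 hm
    have hc' : c ∈ A := (Finset.mem_filter.1 hc).1
    obtain ⟨i, -, rfl⟩ := Finset.mem_image.1 hc'
    exact Finset.card_pos.2 ⟨_, self_mem_cyc _⟩
  have hsum : (nontrivialCycles g).sum + (A.filter P).card = (letters w).card := by
    rw [← hτ.card_letters, ← Finset.sum_filter_add_sum_filter_not A P, hnt, add_comm,
      Finset.card_eq_sum_ones]
    congr 1
    exact Finset.sum_congr rfl fun c hc => (Finset.mem_filter.1 hc).2.1.symm
  have hcard : (nontrivialCycles g).card + (A.filter P).card = A.card := by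
    rw [hnt, Multiset.card_map, add_comm]
    exact Finset.card_filter_add_card_filter_not P
  -- One row for every cycle meeting the word, the trivial ones becoming rows of length `1`, and `δ`
  -- additional rows of length `1`. Enlarging every row by one box gives the size `#letters +
  -- #cycles + 2δ = k`.
  set μ := nontrivialCycles g + Multiset.replicate (δ + (A.filter P).card) 1 with hμ
  have hμpos : ∀ m ∈ μ, 0 < m := by
    intro m hm
    rcases Multiset.mem_add.1 hm with hm | hm
    · exact hpos m hm
    · rw [Multiset.eq_of_mem_replicate hm]; exact one_pos
  have hμcard : μ.card = A.card + δ := by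
    rw [hμ, Multiset.card_add, Multiset.card_replicate]; omega
  have hμsum : μ.sum = (letters w).card + δ := by
    rw [hμ, Multiset.sum_add, Multiset.sum_replicate, smul_eq_mul]; omega
  let σ : k.Partition :=
    { parts := μ.map fun m => m + 1
      parts_pos := by
        intro m hm
        obtain ⟨a, -, rfl⟩ := Multiset.mem_map.1 hm
        exact Nat.succ_pos a
      parts_sum := by
        rw [Multiset.sum_map_add, Multiset.map_id', Multiset.map_const', Multiset.sum_replicate,
          smul_eq_mul]
        omega }
  refine ⟨σ, ?_, ⟨δ + (A.filter P).card, ?_⟩, ?_⟩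
  · simp only [diagramsNoOnes, Finset.mem_filter, Finset.mem_univ, true_and]
    intro h1
    obtain ⟨a, ha, e⟩ := Multiset.mem_map.1 h1
    have := hμpos a ha
    omega
  · change μ = _
    simp only [removeColumn, σ, Multiset.map_map, Function.comp_def, Nat.add_sub_cancel,
      Multiset.map_id']
    exact (Multiset.filter_eq_self.2 fun m hm => (hμpos m hm).ne').symm
  · have : len σ = μ.card := Multiset.card_map _ _
    omega

end Defect

/-! ### Counting colourings by multinomial coefficients -/

section Multinomial

variable {J X T : Type*} [Fintype J] [Fintype X] [Fintype T]

theorem exists_perm_comp_eq {Y : Type*} {f f' : J → Y}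
    (h : ∀ p, Nat.card {b // f b = p} = Nat.card {b // f' b = p}) :
    ∃ σ : Equiv.Perm J, f' ∘ σ = f := by
  have e : ∀ p, Nonempty ({b // f b = p} ≃ {b // f' b = p}) := fun p => by
    have := h p
    rw [Nat.card_eq_fintype_card, Nat.card_eq_fintype_card] at this
    exact Fintype.card_eq.1 this
  exact ⟨Equiv.ofFiberEquiv fun p => (e p).some, funext fun b => Equiv.ofFiberEquiv_map _ b⟩

theorem card_perm_comp_eq {Y : Type*} [Fintype Y] (f : J → Y) (σ₀ : Equiv.Perm J) :
    (Finset.univ.filter fun σ : Equiv.Perm J => f ∘ σ = f ∘ σ₀).card =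
      ∏ p, (Nat.card {b // f b = p}).factorial := by
  simp only [Nat.card_eq_fintype_card]
  rw [← DomMulAct.stabilizer_card f, Fintype.card_subtype]
  refine Finset.card_bij (fun σ _ => σ * σ₀⁻¹) ?_ ?_ ?_
  · intro σ hσ
    refine Finset.mem_filter.2 ⟨Finset.mem_univ _, funext fun b => ?_⟩
    have := congrFun (Finset.mem_filter.1 hσ).2 (σ₀⁻¹ b)
    simpa using this
  · intro σ _ σ' _ e
    exact mul_right_cancel e
  · intro σ hσ
    refine ⟨σ * σ₀, Finset.mem_filter.2 ⟨Finset.mem_univ _, funext fun b => ?_⟩, by simp⟩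
    exact congrFun (Finset.mem_filter.1 hσ).2 (σ₀ b)

/-- The number of ways to color the elements of `J`, which come in kinds, with a given number of
elements of each kind and color. -/
theorem card_colorings (s : J → X) (c : X → T → ℕ)
    (hc : ∀ i, ∑ x, c i x = Nat.card {b // s b = i}) :
    (Finset.univ.filter fun ℓ : J → T =>
        ∀ i x, Nat.card {b // (s b, ℓ b) = (i, x)} = c i x).card =
      ∏ i, Nat.multinomial Finset.univ (c i) := by
  set S := Finset.univ.filter fun ℓ : J → T =>
    ∀ i x, Nat.card {b // (s b, ℓ b) = (i, x)} = c i x with hS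
  have hne : ∃ ℓ₀, ℓ₀ ∈ S := by
    have e : ∀ i, Nonempty ({b // s b = i} ≃ Σ x, Fin (c i x)) := fun i =>
      Fintype.card_eq.1 (by rw [← Nat.card_eq_fintype_card, ← hc, Fintype.card_sigma]; simp)
    let E : J ≃ Σ i, Σ x, Fin (c i x) :=
      (Equiv.sigmaFiberEquiv s).symm.trans (Equiv.sigmaCongrRight fun i => (e i).some)
    refine ⟨fun b => (E b).2.1, Finset.mem_filter.2 ⟨Finset.mem_univ _, fun i x => ?_⟩⟩
    have h1 : Nat.card {b // (s b, (E b).2.1) = (i, x)} =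
        Nat.card {p : Σ i, Σ x, Fin (c i x) // (p.1, p.2.1) = (i, x)} :=
      Nat.card_congr (Equiv.subtypeEquiv E fun b => Iff.rfl)
    have h2 : Nat.card (Fin (c i x)) =
        Nat.card {p : Σ i, Σ x, Fin (c i x) // (p.1, p.2.1) = (i, x)} := by
      refine Nat.card_congr (Equiv.ofBijective (fun m => ⟨⟨i, x, m⟩, rfl⟩) ⟨?_, ?_⟩)
      · intro m m' h
        simpa using h
      · rintro ⟨⟨i', x', m⟩, h⟩
        obtain ⟨h1, h2⟩ := Prod.ext_iff.1 h
        simp only at h1 h2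
        subst h1 h2
        exact ⟨m, rfl⟩
    rw [h1, ← h2, Nat.card_fin]
  obtain ⟨ℓ₀, hℓ₀⟩ := hne
  have hℓ₀' := (Finset.mem_filter.1 hℓ₀).2
  let f : J → X × T := fun b => (s b, ℓ₀ b)
  -- The permutations preserving kinds are counted twice: directly by factorials, and through the
  -- colouring `ℓ₀ ∘ σ`, whose fibres are cosets of the stabilizer of `f` and so have the size `∏ i,
  -- ∏ x, (c i x)!`.
  let H := Finset.univ.filter fun σ : Equiv.Perm J => s ∘ σ = s ∘ (1 : Equiv.Perm J)
  have hmaps : ∀ σ ∈ H, ℓ₀ ∘ σ ∈ S := by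
    intro σ hσ
    refine Finset.mem_filter.2 ⟨Finset.mem_univ _, fun i x => ?_⟩
    rw [← hℓ₀' i x]
    refine Nat.card_congr (Equiv.subtypeEquiv σ fun b => ?_)
    have := congrFun (Finset.mem_filter.1 hσ).2 b
    simp only [Function.comp_apply, Equiv.Perm.coe_one, id] at this
    simp [this]
  have hfib : ∀ ℓ ∈ S, (H.filter fun σ : Equiv.Perm J => ℓ₀ ∘ σ = ℓ).card = ∏ i, ∏ x, (c i x).factorial := by
    intro ℓ hℓ
    obtain ⟨σ₀, hσ₀⟩ := exists_perm_comp_eq (f := fun b => (s b, ℓ b)) (f' := f) (by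
      rintro ⟨i, x⟩
      exact ((Finset.mem_filter.1 hℓ).2 i x).trans (hℓ₀' i x).symm)
    have hp : ∏ i, ∏ x, (c i x).factorial = ∏ p, (Nat.card {b // f b = p}).factorial := by
      rw [Fintype.prod_prod_type]
      exact Finset.prod_congr rfl fun i _ => Finset.prod_congr rfl fun x _ => by rw [← hℓ₀' i x]
    rw [hp, ← card_perm_comp_eq f σ₀]
    congr 1
    ext σ
    simp only [H, Finset.mem_filter, Finset.mem_univ, true_and, hσ₀, f, funext_iff,
      Function.comp_apply, Prod.ext_iff, Equiv.Perm.coe_one, id]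
    exact forall_and.symm
  have hH := card_perm_comp_eq s 1
  have h1 : H.card = S.card * ∏ i, ∏ x, (c i x).factorial := by
    rw [Finset.card_eq_sum_card_fiberwise hmaps, Finset.sum_congr rfl hfib, Finset.sum_const,
      smul_eq_mul]
  have h2 : H.card = (∏ i, Nat.multinomial Finset.univ (c i)) * ∏ i, ∏ x, (c i x).factorial := by
    rw [← Finset.prod_mul_distrib]
    refine hH.trans (Finset.prod_congr rfl fun i _ => ?_)
    rw [mul_comm, Nat.multinomial_spec, hc]
  refine Nat.eq_of_mul_eq_mul_right ?_ (h1.symm.trans h2)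
  exact Finset.prod_pos fun i _ => Finset.prod_pos fun x _ => Nat.factorial_pos _

/-- The family of multisets of sizes of the elements with a given label. -/
noncomputable def labelShape (s : J → ℕ) (ℓ : J → T) : T → Multiset ℕ := fun x =>
  (Finset.univ.filter fun b => ℓ b = x).val.map s

theorem sum_labelShape (s : J → ℕ) (ℓ : J → T) :
    ∑ x, labelShape s ℓ x = Finset.univ.val.map s :=
  sum_map_filter_eq Finset.univ ℓ s

omit [Fintype T] in
theorem count_labelShape (s : J → ℕ) (ℓ : J → T) (x : T) (i : ℕ) :
    (labelShape s ℓ x).count i = Nat.card {b // (s b, ℓ b) = (i, x)} := by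
  rw [labelShape, Multiset.count_map, Nat.card_eq_fintype_card, Fintype.card_subtype, ← Finset.filter_val,
    Finset.filter_filter]
  change Finset.card _ = _
  congr 1
  ext b
  simp only [Finset.mem_filter, Finset.mem_univ, true_and, Prod.ext_iff]
  exact ⟨fun h => ⟨h.2.symm, h.1⟩, fun h => ⟨h.2, h.1.symm⟩⟩

theorem card_labelShape_eq (s : J → ℕ) (ρ : T → Multiset ℕ)
    (hρ : ∑ x, ρ x = Finset.univ.val.map s) :
    (Finset.univ.filter fun ℓ : J → T => labelShape s ℓ = ρ).card =
      multinomials (Finset.univ.val.map s) ρ := by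
  set μ := Finset.univ.val.map s with hμ
  have hmem : ∀ b, s b ∈ μ.toFinset := fun b => by simp [hμ]
  let s' : J → μ.toFinset := fun b => ⟨s b, hmem b⟩
  have hc : ∀ i : μ.toFinset, ∑ x, (ρ x).count i.1 = Nat.card {b // s' b = i} := by
    intro i
    have hcount : ∀ m, μ.count m = (Finset.univ.filter fun b => m = s b).card := fun m =>
      Multiset.count_map _ _ _
    rw [← Multiset.count_sum', hρ, hcount, Nat.card_eq_fintype_card, Fintype.card_subtype]
    congr 1
    ext b
    simp [s', Subtype.ext_iff, eq_comm]
  have := card_colorings s' (fun i x => (ρ x).count i.1) hc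
  rw [multinomials, ← Finset.prod_coe_sort, ← this]
  congr 1
  ext ℓ
  simp only [Finset.mem_filter, Finset.mem_univ, true_and]
  have hs' : ∀ (i : μ.toFinset) x, Nat.card {b // (s' b, ℓ b) = (i, x)} =
      (labelShape s ℓ x).count i.1 := by
    intro i x
    rw [count_labelShape]
    exact Nat.card_congr (Equiv.subtypeEquivRight fun b => by
      simp [s', Prod.ext_iff, Subtype.ext_iff])
  simp only [hs']
  constructor
  · rintro rfl i x; rfl
  · intro h
    funext x
    ext i
    by_cases hi : i ∈ μ.toFinset
    · exact h ⟨i, hi⟩ x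
    · have hz : ∀ ρ' : T → Multiset ℕ, ∑ x, ρ' x = μ → (ρ' x).count i = 0 := by
        intro ρ' hρ'
        have h0 : μ.count i = 0 := Multiset.count_eq_zero.2 fun h => hi (Multiset.mem_toFinset.2 h)
        rw [← hρ', Multiset.count_sum'] at h0
        exact Finset.sum_eq_zero_iff.1 h0 x (Finset.mem_univ x)
      rw [hz _ (sum_labelShape s ℓ), hz ρ hρ]

end Multinomial

theorem mem_labelings {T : Type*} [CommGroup T] [Fintype T] {μ : Multiset ℕ} {y : T}
    {ρ : T → Multiset ℕ} :
    ρ ∈ labelings μ y ↔ ∑ x, ρ x = μ ∧ ∏ x, x ^ (ρ x).card = y := by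
  simp only [labelings, Finset.mem_filter, Fintype.mem_piFinset, Multiset.mem_toFinset,
    Multiset.mem_powerset, and_iff_right_iff_imp]
  rintro ⟨rfl, -⟩ x
  exact Finset.single_le_sum (f := ρ) (fun _ _ => zero_le) (Finset.mem_univ x)

/-- Equal total size means that the same number of rows is added on both sides, even where the
subtraction truncates. -/
theorem iota_injOn {T : Type*} [CommGroup T] [Fintype T] {n : ℕ} {ρ ρ' : T → Multiset ℕ}
    (h : ∑ x, ρ x = ∑ x, ρ' x) (e : iota n ρ = iota n ρ') : ρ = ρ' := by
  have hs : ∑ x, (ρ x).sum = ∑ x, (ρ' x).sum := by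
    rw [← Multiset.sum_sum, h, Multiset.sum_sum]
  funext x
  have := congrFun e x
  simp only [iota, hs] at this
  split_ifs at this
  · exact add_right_cancel this
  · exact this

theorem prod_eq_prod_pow_labelShape {J T : Type*} [Fintype J] [Fintype T] [CommGroup T]
    (s : J → ℕ) (ℓ : J → T) : ∏ b, ℓ b = ∏ x, x ^ (labelShape s ℓ x).card := by
  rw [← Finset.prod_fiberwise Finset.univ ℓ]
  refine Finset.prod_congr rfl fun x _ => ?_
  rw [Finset.prod_congr rfl fun b hb => (Finset.mem_filter.1 hb).2, Finset.prod_const, labelShape,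
    Multiset.card_map]
  rfl

/-! ### Labellings of a fitting word -/

section FittingLabels

variable {T : Type*} [CommGroup T] {n k : ℕ} {w : Fin k → Fin n}
  {π : Finpartition (Finset.univ : Finset (Fin k))}

/-- The number of letters used by a block. -/
def blockSize (π : Finpartition (Finset.univ : Finset (Fin k))) (B : π.parts) : ℕ := B.1.card - 1

variable (w π) in
/-- The products of the labels along the cycles belonging to the blocks of `π`. -/
def blockLabel : (Fin k → T) →* (π.parts → T) where
  toFun x B := ∏ i ∈ B.1.image w, baseLeft w x i.castSucc
  map_one' := by ext B; simp
  map_mul' x x' := by ext B; simp [Finset.prod_mul_distrib]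

theorem blockLabel_apply (x : Fin k → T) (B : π.parts) :
    blockLabel w π x B = ∏ i ∈ B.1.image w, baseLeft w x i.castSucc := rfl

theorem letters_eq_biUnion :
    letters w = Finset.univ.biUnion fun B : π.parts => B.1.image w := by
  ext i
  simp only [letters, Finset.mem_image, Finset.mem_biUnion, Finset.mem_univ, true_and]
  constructor
  · rintro ⟨j, rfl⟩
    exact ⟨⟨π.part j, part_mem_parts π j⟩, j, mem_part_self π j, rfl⟩
  · rintro ⟨B, j, -, rfl⟩
    exact ⟨j, rfl⟩

variable (hf : Fits π w)
include hf

theorem Fits.eq_of_mem_image {B B' : π.parts} {i : Fin n} (h : i ∈ B.1.image w)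
    (h' : i ∈ B'.1.image w) : B = B' := by
  obtain ⟨j, hj, rfl⟩ := Finset.mem_image.1 h
  obtain ⟨j', hj', e⟩ := Finset.mem_image.1 h'
  refine Subtype.ext ?_
  rw [← π.part_eq_of_mem B.2 hj, ← π.part_eq_of_mem B'.2 hj', hf.part_eq e]

theorem Fits.pairwiseDisjoint : Set.PairwiseDisjoint (Finset.univ : Finset π.parts)
    fun B : π.parts => B.1.image w := fun _ _ _ _ hne =>
  Finset.disjoint_left.2 fun _ h h' => hne (hf.eq_of_mem_image h h')

theorem Fits.image_injective : Function.Injective fun B : π.parts => B.1.image w := by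
  intro B B' e
  obtain ⟨j, hj⟩ := π.nonempty_of_mem_parts B.2
  have h := Finset.mem_image_of_mem w hj
  exact hf.eq_of_mem_image h (by simpa only [← e] using h)

theorem Fits.prod_blockLabel (x : Fin k → T) :
    ∏ i : Fin n, baseLeft w x i.castSucc = ∏ B, blockLabel w π x B := by
  simp only [blockLabel_apply]
  rw [← Finset.prod_biUnion hf.pairwiseDisjoint, ← letters_eq_biUnion]
  refine (Finset.prod_subset (Finset.subset_univ _) fun i _ hi => ?_).symm
  exact baseLeft_of_notMem w x i fun j e =>
    hi (Finset.mem_image.2 ⟨j, Finset.mem_univ j, e⟩)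

variable (hs : NoSingletons π)
include hs

/-- The last position repeats the letter of the first one; on the others `w` is injective. -/
theorem Fits.card_image (B : π.parts) : (B.1.image w).card = blockSize π B := by
  obtain ⟨i, hi⟩ := π.nonempty_of_mem_parts B.2
  have hB : B.1 = π.part i := (π.part_eq_of_mem B.2 hi).symm
  have hmax : blockMax π i ∈ B.1 := by
    rw [hB, mem_part_iff, part_blockMax]
  have himg : B.1.image w = (B.1.erase (blockMax π i)).image w := by
    refine subset_antisymm (fun a ha => ?_) (Finset.image_subset_image (Finset.erase_subset _ _))
    obtain ⟨j, hj, rfl⟩ := Finset.mem_image.1 ha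
    by_cases hjm : j = blockMax π i
    · refine Finset.mem_image.2 ⟨blockMin π i, Finset.mem_erase.2 ⟨(hs.blockMin_lt i).ne, ?_⟩, ?_⟩
      · rw [hB, mem_part_iff, part_blockMin]
      · rw [hjm, hf.blockMin_eq_blockMax hs]
    · exact Finset.mem_image_of_mem w (Finset.mem_erase.2 ⟨hjm, hj⟩)
  have hrep : ∀ a ∈ B.1.erase (blockMax π i), rep π a = a := by
    intro a ha
    obtain ⟨h1, h2⟩ := Finset.mem_erase.1 ha
    rw [hB, mem_part_iff] at h2
    exact rep_of_ne (by rwa [blockMax_congr h2])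
  rw [himg, Finset.card_image_of_injOn, Finset.card_erase_of_mem hmax]
  · rfl
  · intro a ha b hb e
    have := (hf a b).1 e
    rwa [hrep a ha, hrep b hb] at this

theorem Fits.card_letters : (letters w).card = ∑ B, blockSize π B := by
  rw [letters_eq_biUnion, Finset.card_biUnion hf.pairwiseDisjoint]
  exact Finset.sum_congr rfl fun B _ => hf.card_image hs B

variable (hπ : IsNonCrossing π)
include hπ

theorem Fits.active_eq {τ : Equiv.Perm (Fin n)} (hτ : Evaluates w τ) :
    active w τ = Finset.univ.image fun B : π.parts => B.1.image w := by
  have hcyc : ∀ i, cyc τ (w i) = (π.part i).image w := by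
    intro i
    ext a
    simp only [mem_cyc, Finset.mem_image, mem_part_iff]
    constructor
    · intro h
      obtain ⟨j, rfl⟩ := hτ.sameCycle_letter h
      exact ⟨j, ((hf.sameCycle_iff hs hπ hτ i j).1 h).symm, rfl⟩
    · rintro ⟨j, hj, rfl⟩
      exact (hf.sameCycle_iff hs hπ hτ i j).2 hj.symm
  ext c
  simp only [active, Finset.mem_image, Finset.mem_univ, true_and, hcyc]
  constructor
  · rintro ⟨i, rfl⟩
    exact ⟨⟨π.part i, part_mem_parts π i⟩, rfl⟩
  · rintro ⟨⟨B, hB⟩, rfl⟩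
    obtain ⟨i, hi⟩ := π.nonempty_of_mem_parts hB
    exact ⟨i, by rw [π.part_eq_of_mem hB hi]⟩

theorem Fits.blockLabel_surjective :
    Function.Surjective (blockLabel w π : (Fin k → T) →* (π.parts → T)) := by
  have hsingle : ∀ (B : π.parts) (a : T),
      Pi.mulSingle B a ∈ (blockLabel w π : (Fin k → T) →* (π.parts → T)).range := by
    intro B a
    obtain ⟨i, hi⟩ := π.nonempty_of_mem_parts B.2
    have hB : B.1 = π.part i := (π.part_eq_of_mem B.2 hi).symm
    set m := blockMin π i with hm
    have hmB : m ∈ B.1 := by rw [hB, mem_part_iff, hm, part_blockMin]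
    have hmne : m ≠ blockMax π m := by
      rw [blockMax_congr (part_blockMin π i)]; exact (hs.blockMin_lt i).ne
    -- The label `a` at all positions after the first one of the block telescopes to `a` at the
    -- letter `w m` and `a⁻¹` at the last letter, which no block contains.
    refine ⟨fun j => if m < j then a else 1, ?_⟩
    funext B'
    rw [blockLabel_apply, baseLeft_step, hf.point_succ hmne, hf.point_length hs hπ]
    have : ∀ b : Fin n, (Pi.mulSingle (w m).castSucc a / Pi.mulSingle (Fin.last n) a :
        Fin (n + 1) → T) b.castSucc = if w m = b then a else 1 := by
      intro b
      rw [Pi.div_apply, Pi.mulSingle_eq_of_ne (Fin.castSucc_lt_last b).ne, div_one,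
        Pi.mulSingle_apply]
      simp [eq_comm]
    simp only [this]
    rw [Finset.prod_ite_eq, Pi.mulSingle_apply]
    refine if_congr ?_ rfl rfl
    constructor
    · intro h
      exact hf.eq_of_mem_image h (Finset.mem_image_of_mem w hmB)
    · rintro rfl
      exact Finset.mem_image_of_mem w hmB
  intro ℓ
  have : ℓ ∈ (blockLabel w π : (Fin k → T) →* (π.parts → T)).range := by
    rw [← Finset.univ_prod_mulSingle ℓ]
    exact Subgroup.prod_mem _ fun B _ => hsingle B _
  exact this

variable [Fintype T]

/-- All fibres of a surjective homomorphism of finite groups have the same size. -/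
theorem Fits.card_blockLabel_fiber (ℓ : π.parts → T) :
    (Finset.univ.filter fun x : Fin k → T => blockLabel w π x = ℓ).card =
      Fintype.card T ^ (k - π.parts.card) := by
  have hsurj := hf.blockLabel_surjective (T := T) hs hπ
  have hconst : ∀ ℓ', (Finset.univ.filter fun x : Fin k → T => blockLabel w π x = ℓ').card =
      (Finset.univ.filter fun x : Fin k → T => blockLabel w π x = ℓ).card := fun ℓ' =>
    MonoidHom.card_fiber_eq_of_mem_range _ (hsurj ℓ') (hsurj ℓ)
  have htot : Fintype.card (Fin k → T) = Fintype.card (π.parts → T) *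
      (Finset.univ.filter fun x : Fin k → T => blockLabel w π x = ℓ).card := by
    rw [← Finset.card_univ, Finset.card_eq_sum_card_fiberwise (f := blockLabel w π)
      (t := Finset.univ) (fun _ _ => Finset.mem_coe.2 (Finset.mem_univ _)),
      Finset.sum_congr rfl fun ℓ' _ => hconst ℓ', Finset.sum_const, smul_eq_mul, Finset.card_univ]
  have hle : π.parts.card ≤ k := by simpa using π.card_parts_le_card
  rw [Fintype.card_fun, Fintype.card_fun, Fintype.card_fin, Fintype.card_coe] at htot
  refine Nat.eq_of_mul_eq_mul_left (pow_pos (Fintype.card_pos (α := T)) π.parts.card) ?_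
  rw [← htot, ← pow_add]
  congr 1
  omega

theorem Fits.type_eq {y : T} {x : Fin k → T} {g : Wreath T n}
    (hg : IsValue y (fun i => (w i, x i)) g) :
    type g = iota n (labelShape (blockSize π) (blockLabel w π x)) := by
  have hτ : Evaluates w g.right := hg.evaluates
  have hleft : ∀ i, g.left i = baseLeft w x i.castSucc := hg.left_apply
  have hsize : ∑ z : T, (labelShape (blockSize π) (blockLabel w π x) z).sum =
      (letters w).card := by
    rw [← Multiset.sum_sum, sum_labelShape, hf.card_letters hs]
    rfl
  have hcyc : ∀ z, ((cycles g.right).filter fun c => ∏ i ∈ c, g.left i = z).val =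
      ((active w g.right).filter fun c => ∏ i ∈ c, g.left i = z).val +
      (((letters w)ᶜ.image fun i => ({i} : Finset (Fin n))).filter
        fun c => ∏ i ∈ c, g.left i = z).val := by
    intro z
    rw [hτ.cycles_eq, Finset.filter_union, ← Finset.disjUnion_eq_union _ _
      (Finset.disjoint_filter_filter (disjoint_active w g.right))]
    rfl
  have hact : ∀ z, ((active w g.right).filter fun c => ∏ i ∈ c, g.left i = z).val.map Finset.card =
      labelShape (blockSize π) (blockLabel w π x) z := by
    intro z
    rw [hf.active_eq hs hπ hτ, Finset.filter_image,
      Finset.image_val_of_injOn hf.image_injective.injOn, Multiset.map_map, labelShape]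
    simp only [hleft]
    exact Multiset.map_congr rfl fun B _ => hf.card_image hs B
  have htriv : ∀ i ∈ (letters w)ᶜ, g.left i = 1 := fun i hi => hg.left_of_notMem i fun j e =>
    (Finset.mem_compl.1 hi) (Finset.mem_image.2 ⟨j, Finset.mem_univ j, e⟩)
  funext z
  rw [type, hcyc, Multiset.map_add, hact, iota, hsize, Finset.filter_image,
    Finset.image_val_of_injOn (Finset.singleton_injective.injOn), Multiset.map_map]
  simp only [Finset.prod_singleton, Function.comp_def, Finset.card_singleton, Multiset.map_const']
  by_cases hz : z = 1
  · rw [if_pos hz, Finset.filter_true_of_mem fun i hi => (htriv i hi).trans hz.symm]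
    congr 2
    change Finset.card _ = _
    rw [Finset.card_compl, Fintype.card_fin]
  · rw [if_neg hz, Finset.filter_false_of_mem fun i hi e => hz (e.symm.trans (htriv i hi))]
    simp

/-- The number of labellings of a fitting word leading to a given type. -/
theorem Fits.card_labels {y : T} {ρ : T → Multiset ℕ}
    (hρ : ρ ∈ labelings (Finset.univ.val.map (blockSize π)) y) :
    (Finset.univ.filter fun x : Fin k → T =>
      ∃ g, IsValue y (fun i => (w i, x i)) g ∧ type g = iota n ρ).card =
      Fintype.card T ^ (k - π.parts.card) *
        multinomials (Finset.univ.val.map (blockSize π)) ρ := by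
  obtain ⟨h1, h2⟩ := mem_labelings.1 hρ
  obtain ⟨τ, hτ⟩ := hf.exists_evaluates hs hπ
  have hiff : ∀ x : Fin k → T, (∃ g, IsValue y (fun i => (w i, x i)) g ∧ type g = iota n ρ) ↔
      labelShape (blockSize π) (blockLabel w π x) = ρ := by
    intro x
    constructor
    · rintro ⟨g, hg, ht⟩
      rw [hf.type_eq hs hπ hg] at ht
      exact iota_injOn ((sum_labelShape _ _).trans h1.symm) ht
    · intro h
      have hy : ∃ g, IsValue y (fun i => (w i, x i)) g := by
        rw [exists_isValue_iff (W := fun i => (w i, x i)) hτ, hf.prod_blockLabel,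
          prod_eq_prod_pow_labelShape (blockSize π), h, h2]
      obtain ⟨g, hg⟩ := hy
      exact ⟨g, hg, by rw [hf.type_eq hs hπ hg, h]⟩
  simp only [hiff]
  have hc : (Finset.univ.filter fun ℓ : π.parts → T => labelShape (blockSize π) ℓ = ρ).card =
      multinomials (Finset.univ.val.map (blockSize π)) ρ := by
    convert card_labelShape_eq (blockSize π) ρ h1
  rw [← hc, mul_comm, Finset.card_eq_sum_card_fiberwise (f := blockLabel w π)
    (t := Finset.univ.filter fun ℓ => labelShape (blockSize π) ℓ = ρ)
    (fun x hx => by simpa using hx), ← smul_eq_mul, ← Finset.sum_const]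
  refine Finset.sum_congr rfl fun ℓ hℓ => ?_
  rw [← hf.card_blockLabel_fiber hs hπ ℓ, Finset.filter_filter]
  congr 1
  ext x
  simp only [Finset.mem_filter, Finset.mem_univ, true_and, and_iff_right_iff_imp]
  rintro rfl
  exact (Finset.mem_filter.1 hℓ).2

end FittingLabels

/-! ### Counting fitting words and words with few letters -/

section CountingWords

variable {n k : ℕ} {π : Finpartition (Finset.univ : Finset (Fin k))}

/-- The values of `rep` are exactly the positions that are not the last of their block. -/
theorem NoSingletons.card_image_rep (hs : NoSingletons π) :
    (Finset.univ.image (rep π)).card = k - π.parts.card := by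
  have himg : Finset.univ.image (rep π) = (Finset.univ.image (blockMax π))ᶜ := by
    ext i
    simp only [Finset.mem_image, Finset.mem_compl, Finset.mem_univ, true_and]
    constructor
    · rintro ⟨j, rfl⟩ ⟨a, ha⟩
      have hmax : rep π j = blockMax π (rep π j) := by
        rw [← ha, blockMax_congr (part_blockMax π a)]
      have h1 := hs.rep_rep j
      rw [hmax, rep_blockMax, ← hmax] at h1
      exact (hs.blockMin_lt (rep π j)).ne (h1.trans hmax)
    · intro h
      exact ⟨i, rep_of_ne fun e => h ⟨i, e.symm⟩⟩
  have hparts : (Finset.univ.image (blockMax π)).card = π.parts.card := by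
    refine Finset.card_bij (fun i _ => π.part i) (fun i _ => part_mem_parts π i) ?_ ?_
    · intro i hi j hj e
      obtain ⟨a, -, rfl⟩ := Finset.mem_image.1 hi
      obtain ⟨b, -, rfl⟩ := Finset.mem_image.1 hj
      rw [part_blockMax, part_blockMax] at e
      exact blockMax_congr e
    · intro B hB
      obtain ⟨i, hi⟩ := π.nonempty_of_mem_parts hB
      exact ⟨_, Finset.mem_image_of_mem _ (Finset.mem_univ i),
        by rw [part_blockMax, π.part_eq_of_mem hB hi]⟩
  rw [himg, Finset.card_compl, Fintype.card_fin, hparts]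

/-- A fitting word amounts to an injection of the values of `rep` into the letters. -/
theorem NoSingletons.card_fits (hs : NoSingletons π) (n : ℕ) :
    (Finset.univ.filter fun w : Fin k → Fin n => Fits π w).card =
      n.descFactorial (k - π.parts.card) := by
  have h : Fintype.card (Finset.univ.image (rep π) ↪ Fin n) =
      n.descFactorial (k - π.parts.card) := by
    rw [Fintype.card_embedding_eq, Fintype.card_coe, hs.card_image_rep, Fintype.card_fin]
  have hmem : ∀ i, rep π i ∈ Finset.univ.image (rep π) := fun i =>
    Finset.mem_image_of_mem _ (Finset.mem_univ i)
  rw [← h, ← Finset.card_univ]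
  symm
  refine Finset.card_bij (fun f _ i => f ⟨rep π i, hmem i⟩) ?_ ?_ ?_
  · intro f _
    refine Finset.mem_filter.2 ⟨Finset.mem_univ _, fun i j => ?_⟩
    rw [f.injective.eq_iff, Subtype.mk.injEq]
  · intro f _ f' _ e
    ext ⟨r, hr⟩
    obtain ⟨i, -, rfl⟩ := Finset.mem_image.1 hr
    exact congrArg Fin.val (congrFun e i)
  · intro w hw
    have hw' : Fits π w := (Finset.mem_filter.1 hw).2
    have hinj : Function.Injective fun r : Finset.univ.image (rep π) => w r.1 := by
      rintro ⟨r, hr⟩ ⟨r', hr'⟩ e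
      obtain ⟨i, -, rfl⟩ := Finset.mem_image.1 hr
      obtain ⟨j, -, rfl⟩ := Finset.mem_image.1 hr'
      have := (hw' _ _).1 e
      rw [hs.rep_rep, hs.rep_rep] at this
      exact Subtype.ext this
    exact ⟨⟨_, hinj⟩, Finset.mem_univ _, funext fun i => (hw' _ _).2 (hs.rep_rep i)⟩

theorem finpartition_eq_of_part {π' : Finpartition (Finset.univ : Finset (Fin k))}
    (h : ∀ i j, π.part i = π.part j ↔ π'.part i = π'.part j) : π = π' := by
  have hpart : ∀ i, π.part i = π'.part i := fun i => by
    ext j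
    rw [mem_part_iff, mem_part_iff, h]
  have hle : ∀ {p q : Finpartition (Finset.univ : Finset (Fin k))},
      (∀ i, p.part i = q.part i) → p.parts ⊆ q.parts := by
    intro p q hpq B hB
    obtain ⟨i, hi⟩ := p.nonempty_of_mem_parts hB
    rw [← p.part_eq_of_mem hB hi, hpq]
    exact part_mem_parts q i
  exact Finpartition.ext (subset_antisymm (hle hpart) (hle fun i => (hpart i).symm))

/-- The word determines its product `τ`, whose cycles determine the blocks. Hence no fitting word is
counted for two partitions. -/
theorem Fits.unique {π' : Finpartition (Finset.univ : Finset (Fin k))} {w : Fin k → Fin n}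
    (hf : Fits π w) (hs : NoSingletons π) (hπ : IsNonCrossing π)
    (hf' : Fits π' w) (hs' : NoSingletons π') (hπ' : IsNonCrossing π') : π = π' := by
  obtain ⟨τ, hτ⟩ := hf.exists_evaluates hs hπ
  exact finpartition_eq_of_part fun i j =>
    (hf.sameCycle_iff hs hπ hτ i j).symm.trans (hf'.sameCycle_iff hs' hπ' hτ i j)

theorem mem_NC {σ : k.Partition} :
    π ∈ NC σ ↔ IsNonCrossing π ∧ π.parts.val.map Finset.card = σ.parts := by
  simp [NC]

theorem mem_diagramsNoOnes {σ : k.Partition} : σ ∈ diagramsNoOnes k ↔ 1 ∉ σ.parts := by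
  simp [diagramsNoOnes]

theorem noSingletons_of_mem_NC {σ : k.Partition} (hσ : σ ∈ diagramsNoOnes k) (h : π ∈ NC σ) :
    NoSingletons π := by
  intro B hB e
  refine mem_diagramsNoOnes.1 hσ ?_
  rw [← (mem_NC.1 h).2, ← e]
  exact Multiset.mem_map_of_mem _ hB

theorem card_parts_of_mem_NC {σ : k.Partition} (h : π ∈ NC σ) : π.parts.card = len σ := by
  rw [len, ← (mem_NC.1 h).2, Multiset.card_map]
  rfl

theorem map_blockSize_of_mem_NC {σ : k.Partition} (hσ : σ ∈ diagramsNoOnes k) (h : π ∈ NC σ) :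
    Finset.univ.val.map (blockSize π) = removeColumn σ := by
  rw [removeColumn, Multiset.filter_eq_self.2]
  · rw [← (mem_NC.1 h).2, Multiset.map_map]
    change Multiset.map _ π.parts.attach.val = _
    conv_rhs => rw [← Multiset.attach_map_val π.parts.val, Multiset.map_map]
    rfl
  · intro m hm
    obtain ⟨a, ha, rfl⟩ := Multiset.mem_map.1 hm
    have h1 := σ.parts_pos ha
    have h2 : a ≠ 1 := fun e => mem_diagramsNoOnes.1 hσ (e ▸ ha)
    omega

theorem NoSingletons.exists_mem_NC (hs : NoSingletons π) (hπ : IsNonCrossing π) :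
    ∃ σ ∈ diagramsNoOnes k, π ∈ NC σ := by
  let σ : k.Partition :=
    { parts := π.parts.val.map Finset.card
      parts_pos := by
        intro m hm
        obtain ⟨B, hB, rfl⟩ := Multiset.mem_map.1 hm
        exact Finset.card_pos.2 (π.nonempty_of_mem_parts hB)
      parts_sum := π.sum_card_parts.trans (by simp) }
  refine ⟨σ, mem_diagramsNoOnes.2 fun h => ?_, mem_NC.2 ⟨hπ, rfl⟩⟩
  obtain ⟨B, hB, e⟩ := Multiset.mem_map.1 h
  exact hs B hB e

/-- The word `w` arises from a noncrossing partition with block sizes `σ`. -/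
def FitsDiagram (σ : k.Partition) (w : Fin k → Fin n) : Prop := ∃ π ∈ NC σ, Fits π w

theorem FitsDiagram.unique {σ σ' : k.Partition} (hσ : σ ∈ diagramsNoOnes k)
    (hσ' : σ' ∈ diagramsNoOnes k) {w : Fin k → Fin n} (h : FitsDiagram σ w)
    (h' : FitsDiagram σ' w) : σ = σ' := by
  obtain ⟨π, hπ, hf⟩ := h
  obtain ⟨π', hπ', hf'⟩ := h'
  have := hf.unique (noSingletons_of_mem_NC hσ hπ) (mem_NC.1 hπ).1 hf'
    (noSingletons_of_mem_NC hσ' hπ') (mem_NC.1 hπ').1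
  subst this
  exact Nat.Partition.ext ((mem_NC.1 hπ).2.symm.trans (mem_NC.1 hπ').2)

theorem card_fitsDiagram {σ : k.Partition} (hσ : σ ∈ diagramsNoOnes k) (n : ℕ) :
    (Finset.univ.filter fun w : Fin k → Fin n => FitsDiagram σ w).card =
      (NC σ).card * n.descFactorial (k - len σ) := by
  have : (Finset.univ.filter fun w : Fin k → Fin n => FitsDiagram σ w) =
      (NC σ).biUnion fun π => Finset.univ.filter fun w : Fin k → Fin n => Fits π w := by
    ext w
    rw [Finset.mem_filter, Finset.mem_biUnion]
    simp only [Finset.mem_filter, Finset.mem_univ, true_and]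
    rfl
  rw [this, Finset.card_biUnion, ← smul_eq_mul, ← Finset.sum_const]
  · refine Finset.sum_congr rfl fun π hπ => ?_
    rw [(noSingletons_of_mem_NC hσ hπ).card_fits, card_parts_of_mem_NC hπ]
  · intro π hπ π' hπ' hne
    refine Finset.disjoint_left.2 fun w hw hw' => hne ?_
    exact (Finset.mem_filter.1 hw).2.unique (noSingletons_of_mem_NC hσ hπ) (mem_NC.1 hπ).1
      (Finset.mem_filter.1 hw').2 (noSingletons_of_mem_NC hσ hπ') (mem_NC.1 hπ').1

/-- The letters are enlarged to a set of exactly `D` elements; there are at most `n ^ D` such sets,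
each carrying `D ^ k` words. -/
theorem card_few_letters {D : ℕ} (h : D ≤ n) :
    (Finset.univ.filter fun w : Fin k → Fin n => (letters w).card ≤ D).card ≤ n ^ D * D ^ k := by
  have hsub : (Finset.univ.filter fun w : Fin k → Fin n => (letters w).card ≤ D) ⊆
      (Finset.univ.powersetCard D : Finset (Finset (Fin n))).biUnion fun S =>
        Fintype.piFinset fun _ : Fin k => S := by
    intro w hw
    obtain ⟨S, hS, hcard⟩ := Finset.exists_superset_card_eq (Finset.mem_filter.1 hw).2
      (by simpa using h)
    refine Finset.mem_biUnion.2 ⟨S, Finset.mem_powersetCard.2 ⟨Finset.subset_univ _, hcard⟩, ?_⟩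
    exact Fintype.mem_piFinset.2 fun j => hS (Finset.mem_image_of_mem w (Finset.mem_univ j))
  refine (Finset.card_le_card hsub).trans (Finset.card_biUnion_le.trans ?_)
  rw [Finset.sum_congr rfl (g := fun _ => D ^ k), Finset.sum_const, Finset.card_powersetCard,
    Finset.card_univ, Fintype.card_fin, smul_eq_mul]
  · exact Nat.mul_le_mul_right _ (Nat.choose_le_pow n D)
  · intro S hS
    rw [Fintype.card_piFinset_const, (Finset.mem_powersetCard.1 hS).2]

theorem card_few_letters_labelled {T : Type*} [Fintype T] {D : ℕ} (h : D ≤ n) :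
    (Finset.univ.filter fun W : Fin k → Fin n × T =>
      (letters fun i => (W i).1).card ≤ D).card ≤ n ^ D * D ^ k * Fintype.card T ^ k := by
  refine le_trans ?_ (Nat.mul_le_mul_right _ (card_few_letters (k := k) h))
  have hT : Fintype.card T ^ k = (Finset.univ : Finset (Fin k → T)).card := by simp
  rw [hT, ← Finset.card_product]
  refine Finset.card_le_card_of_injOn (fun W => (fun i => (W i).1, fun i => (W i).2)) ?_ ?_
  · intro W hW
    have := (Finset.mem_filter.1 (Finset.mem_coe.1 hW)).2
    exact Finset.mem_coe.2 (Finset.mem_product.2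
      ⟨Finset.mem_filter.2 ⟨Finset.mem_univ _, this⟩, Finset.mem_univ _⟩)
  · intro W _ W' _ e
    funext i
    exact Prod.ext (congrFun (Prod.ext_iff.1 e).1 i) (congrFun (Prod.ext_iff.1 e).2 i)

end CountingWords

/-- The quotient lies between `(1 - d/n)^d` and `1`, and Bernoulli's inequality bounds the former
below by `1 - d²/n`. -/
theorem descFactorial_div_pow_sub_one_isBigO (d : ℕ) :
    (fun n : ℕ => (n.descFactorial d : ℝ) / (n : ℝ) ^ d - 1) =O[atTop] fun n : ℕ => (n : ℝ)⁻¹ := by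
  refine IsBigO.of_bound ((d : ℝ) * d) ?_
  filter_upwards [eventually_ge_atTop (d + 1)] with n hn
  have hn0 : (0 : ℝ) < n := by exact_mod_cast (by omega : 0 < n)
  have hpow : (0 : ℝ) < (n : ℝ) ^ d := pow_pos hn0 d
  have hup : (n.descFactorial d : ℝ) / (n : ℝ) ^ d ≤ 1 := by
    rw [div_le_one hpow]
    exact_mod_cast Nat.descFactorial_le_pow n d
  have hdn : (d : ℝ) / n ≤ 1 := by
    rw [div_le_one hn0]
    exact_mod_cast (by omega : d ≤ n)
  have hlow : 1 - (d : ℝ) * d / n ≤ (n.descFactorial d : ℝ) / (n : ℝ) ^ d := by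
    have h1 : ((n - d : ℕ) : ℝ) ^ d ≤ n.descFactorial d := by
      exact_mod_cast (Nat.pow_le_pow_left (by omega : n - d ≤ n + 1 - d) d).trans
        (Nat.pow_sub_le_descFactorial n d)
    have h2 := one_add_mul_le_pow (a := -((d : ℝ) / n)) (by linarith) d
    have h3 : (1 + -((d : ℝ) / n)) ^ d = ((n - d : ℕ) : ℝ) ^ d / (n : ℝ) ^ d := by
      rw [← div_pow, Nat.cast_sub (by omega)]
      congr 1
      field_simp
      ring
    rw [h3] at h2
    calc 1 - (d : ℝ) * d / n = 1 + (d : ℝ) * -((d : ℝ) / n) := by ring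
      _ ≤ _ := h2
      _ ≤ _ := by gcongr
  rw [Real.norm_eq_abs, abs_of_nonpos (by linarith), Real.norm_eq_abs,
    abs_of_pos (inv_pos.2 hn0), ← div_eq_mul_inv]
  linarith

theorem sum_eq_sum_of_existsUnique {α β M : Type*} [AddCommMonoid M] (s : Finset α) (t : Finset β)
    (P : β → α → Prop) (f : α → M) (h : ∀ a ∈ s, ∃! b, b ∈ t ∧ P b a) :
    ∑ a ∈ s, f a = ∑ b ∈ t, ∑ a ∈ s.filter (P b), f a := by
  simp only [Finset.sum_filter]
  rw [Finset.sum_comm]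
  refine Finset.sum_congr rfl fun a ha => ?_
  obtain ⟨b, ⟨hb, hP⟩, huniq⟩ := h a ha
  rw [Finset.sum_eq_single b, if_pos hP]
  · intro b' hb' hne
    exact if_neg fun hP' => hne (huniq b' ⟨hb', hP'⟩)
  · exact fun h => absurd hb h

/-! ### Main words and remaining words -/

section Expansion

variable {T : Type*} [CommGroup T] {n k : ℕ}

/-- The element of `𝔖_n(T)` coming from a word, if there is one. -/
noncomputable def value (y : T) (W : Fin k → Fin n × T) : Wreath T n :=
  if h : ∃ g, IsValue y W g then h.choose else 1

theorem isValue_value {y : T} {W : Fin k → Fin n × T} (h : ∃ g, IsValue y W g) :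
    IsValue y W (value y W) := by
  rw [value, dif_pos h]
  exact h.choose_spec

theorem IsValue.value_eq {y : T} {W : Fin k → Fin n × T} {g : Wreath T n} (h : IsValue y W g) :
    value y W = g :=
  incl_injective T n ((isValue_value ⟨g, h⟩).trans h.symm)

variable [Fintype T]

/-- The words which contribute to the restriction. -/
noncomputable def validWords (n k : ℕ) (y : T) : Finset (Fin k → Fin n × T) :=
  Finset.univ.filter fun W => ∃ g, IsValue y W g

theorem restrictE_jm (n k : ℕ) (y : T) :
    restrictE (jm T n ^ k * MonoidAlgebra.of ℂ _ (atPos y (Fin.last n))) =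
      ∑ W ∈ validWords n k y, MonoidAlgebra.of ℂ _ (value y W) := by
  rw [jm_pow_mul, restrictE_sum, validWords, Finset.sum_filter]
  refine Finset.sum_congr rfl fun W _ => ?_
  split_ifs with h
  · rw [← isValue_value h, restrictE_of_incl]
  · exact restrictE_of_notMem _ fun ⟨g, hg⟩ => h ⟨g, hg⟩

/-- The words fitting the diagram `σ` whose value has the type given by `ρ`. -/
noncomputable def mainWords (n : ℕ) (y : T) (σ : k.Partition) (ρ : T → Multiset ℕ) :
    Finset (Fin k → Fin n × T) :=
  (validWords n k y).filter fun W =>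
    FitsDiagram σ (fun i => (W i).1) ∧ type (value y W) = iota n ρ

/-- Every fitting `w` admits the same number of suitable labellings, independent of the partition in
`NC σ` that it fits. -/
theorem card_mainWords {σ : k.Partition} (hσ : σ ∈ diagramsNoOnes k) {y : T}
    {ρ : T → Multiset ℕ} (hρ : ρ ∈ labelings (removeColumn σ) y) (n : ℕ) :
    (mainWords n y σ ρ).card = (NC σ).card * n.descFactorial (k - len σ) *
      (Fintype.card T ^ (k - len σ) * multinomials (removeColumn σ) ρ) := by
  rw [← card_fitsDiagram hσ, Finset.card_eq_sum_card_fiberwise (f := fun W i => (W i).1)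
    (t := Finset.univ.filter fun w : Fin k → Fin n => FitsDiagram σ w), ← smul_eq_mul,
    ← Finset.sum_const]
  · refine Finset.sum_congr rfl fun w hw => ?_
    obtain ⟨π, hπ, hf⟩ := (Finset.mem_filter.1 hw).2
    have hmap := map_blockSize_of_mem_NC hσ hπ
    have h := hf.card_labels (noSingletons_of_mem_NC hσ hπ) (mem_NC.1 hπ).1 (hmap ▸ hρ)
    rw [hmap, card_parts_of_mem_NC hπ] at h
    rw [← h]
    refine Finset.card_bij (fun W _ i => (W i).2) ?_ ?_ ?_
    · intro W hW
      simp only [mainWords, validWords, Finset.mem_filter, Finset.mem_univ, true_and] at hW ⊢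
      obtain ⟨⟨hv, -, ht⟩, rfl⟩ := hW
      exact ⟨value y W, isValue_value hv, ht⟩
    · intro W hW W' hW' e
      have e1 := (Finset.mem_filter.1 hW).2.trans (Finset.mem_filter.1 hW').2.symm
      funext i
      exact Prod.ext (congrFun e1 i) (congrFun e i)
    · intro x hx
      obtain ⟨g, hg, ht⟩ := (Finset.mem_filter.1 hx).2
      refine ⟨fun i => (w i, x i), ?_, rfl⟩
      simp only [mainWords, validWords, Finset.mem_filter, Finset.mem_univ, true_and]
      exact ⟨⟨⟨g, hg⟩, ⟨π, hπ, hf⟩, by rw [hg.value_eq, ht]⟩, trivial⟩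
  · intro W hW
    have := (Finset.mem_filter.1 (Finset.mem_coe.1 hW)).2.1
    exact Finset.mem_coe.2 (Finset.mem_filter.2 ⟨Finset.mem_univ _, this⟩)

theorem sum_mainWords (n : ℕ) (y : T) (σ : k.Partition) (ρ : T → Multiset ℕ) :
    ∑ W ∈ mainWords n y σ ρ, MonoidAlgebra.of ℂ _ (value y W) =
      ((mainWords n y σ ρ).card : ℂ) • normIndicator n (iota n ρ) := by
  have hval : ∀ (h : Wreath T n), ∀ W ∈ mainWords n y σ ρ,
      IsValue y (wordEquiv k h W) (h * value y W * h⁻¹) := fun h W hW =>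
    (isValue_value (Finset.mem_filter.1 (Finset.mem_filter.1 hW).1).2).wordEquiv h
  refine sum_of_eq_card_smul_normIndicator _ _ _ (fun W hW => (Finset.mem_filter.1 hW).2.2)
    (wordEquiv k) (fun h W hW => ?_) fun h W hW => (hval h W hW).value_eq
  have hv := hval h W hW
  obtain ⟨-, ⟨π, hπ, hf⟩, ht⟩ := Finset.mem_filter.1 hW
  refine Finset.mem_filter.2 ⟨Finset.mem_filter.2 ⟨Finset.mem_univ _, _, hv⟩,
    ⟨π, hπ, fun i j => ?_⟩, ?_⟩
  · rw [← hf i j]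
    exact h.right.injective.eq_iff
  · rw [hv.value_eq, type_conj, ht]

theorem sum_fitsDiagram {σ : k.Partition} (hσ : σ ∈ diagramsNoOnes k) (n : ℕ) (y : T) :
    ∑ W ∈ (validWords n k y).filter (fun W => FitsDiagram σ fun i => (W i).1),
        MonoidAlgebra.of ℂ _ (value y W) =
      ∑ ρ ∈ labelings (removeColumn σ) y,
        ((mainWords n y σ ρ).card : ℂ) • normIndicator n (iota n ρ) := by
  rw [sum_eq_sum_of_existsUnique _ (labelings (removeColumn σ) y)
    (fun ρ W => type (value y W) = iota n ρ)]
  · refine Finset.sum_congr rfl fun ρ _ => ?_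
    rw [Finset.filter_filter, ← sum_mainWords]
    refine Finset.sum_congr ?_ fun _ _ => rfl
    ext W
    simp only [mainWords, Finset.mem_filter]
  · intro W hW
    obtain ⟨hv, π, hπ, hf⟩ := Finset.mem_filter.1 hW
    have hval := isValue_value (Finset.mem_filter.1 hv).2
    have hs := noSingletons_of_mem_NC hσ hπ
    have hnc := (mem_NC.1 hπ).1
    have hmap := map_blockSize_of_mem_NC hσ hπ
    have hsum : ∑ z, labelShape (blockSize π)
        (blockLabel (fun i => (W i).1) π fun i => (W i).2) z = removeColumn σ :=
      (sum_labelShape _ _).trans hmap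
    refine ⟨_, ⟨mem_labelings.2 ⟨hsum, ?_⟩, hf.type_eq hs hnc hval⟩, ?_⟩
    · rw [← prod_eq_prod_pow_labelShape, ← hf.prod_blockLabel]
      exact (exists_isValue_iff hval.evaluates).1 ⟨_, hval⟩
    · rintro ρ ⟨hρ, ht⟩
      exact iota_injOn ((mem_labelings.1 hρ).1.trans hsum.symm)
        (ht.symm.trans (hf.type_eq hs hnc hval))

/-- A word not coming from a noncrossing partition has few letters. -/
theorem exists_diagram_of_not_fits {y : T} {W : Fin k → Fin n × T} (hv : ∃ g, IsValue y W g)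
    (hW : ¬ ∃ σ ∈ diagramsNoOnes k, FitsDiagram σ fun i => (W i).1) :
    ∃ σ ∈ diagramsNoOnes k,
      (∃ j, nontrivialCycles (value y W) + Multiset.replicate j 1 = removeColumn σ) ∧
        (letters fun i => (W i).1).card + 1 + len σ ≤ k := by
  have hval := isValue_value hv
  obtain ⟨δ, hδ⟩ := hval.evaluates.exists_defect
  obtain ⟨σ, hσ, hj, he⟩ := hval.exists_diagram hδ
  refine ⟨σ, hσ, hj, ?_⟩
  rcases Nat.eq_zero_or_pos δ with rfl | hpos
  · obtain ⟨hs, hf, hnc⟩ := hval.evaluates.fits_of_card_eq (by simpa using hδ)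
    obtain ⟨σ', hσ', hπ⟩ := hs.exists_mem_NC hnc
    exact absurd ⟨σ', hσ', _, hπ, hf⟩ hW
  · omega

end Expansion

end

end WreathJM

/-! ### Assembling the expansion -/

open WreathJM in
theorem theorem1p2 {T : Type*} [CommGroup T] [Fintype T] (k : ℕ) (y : T) :
    (∀ n : ℕ,
      WreathJM.restrictE (WreathJM.jm T n ^ k *
          MonoidAlgebra.of ℂ _ (WreathJM.atPos y (Fin.last n))) ∈
        Subalgebra.center ℂ (WreathJM.GroupAlg T n)) ∧
    ∃ (ε : k.Partition → ℕ → ℝ)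
      (N : k.Partition → (n : ℕ) → Multiset (WreathJM.Wreath T n)),
      (∀ σ ∈ WreathJM.diagramsNoOnes k, ε σ =O[atTop] fun n : ℕ => (n : ℝ)⁻¹) ∧
      (∀ σ ∈ WreathJM.diagramsNoOnes k,
        (∀ n : ℕ, ∀ g ∈ N σ n, ∃ j : ℕ,
          WreathJM.nontrivialCycles g + Multiset.replicate j 1 = WreathJM.removeColumn σ) ∧
        (fun n : ℕ => ((N σ n).card : ℝ)) =O[atTop]
          fun n : ℕ => (n : ℝ) ^ ((k : ℤ) - (WreathJM.len σ : ℤ) - 1)) ∧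
      ∀ᶠ n : ℕ in atTop,
        WreathJM.restrictE (WreathJM.jm T n ^ k *
            MonoidAlgebra.of ℂ _ (WreathJM.atPos y (Fin.last n))) =
          ∑ σ ∈ WreathJM.diagramsNoOnes k,
            ((∑ ρ ∈ WreathJM.labelings (WreathJM.removeColumn σ) y,
                (((WreathJM.NC σ).card : ℂ) * (n : ℂ) ^ (k - WreathJM.len σ) *
                    ((1 + ε σ n : ℝ) : ℂ) *
                    (Fintype.card T : ℂ) ^ (k - WreathJM.len σ) *
                    (WreathJM.multinomials (WreathJM.removeColumn σ) ρ : ℂ)) •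
                  WreathJM.normIndicator n (WreathJM.iota n ρ)) +
              ((N σ n).map fun g => MonoidAlgebra.of ℂ (WreathJM.Wreath T n) g).sum) := by
  classical
  refine ⟨fun n => restrictE_jm_mem_center k n y, ?_⟩
  -- The diagram is made a total function of the word; its values at words outside `bad` play no
  -- role.
  have hdg : ∀ (n : ℕ) (W : Fin k → Fin n × T), ∃ σ : k.Partition,
      (∃ g, IsValue y W g) → (¬ ∃ σ ∈ diagramsNoOnes k, FitsDiagram σ fun i => (W i).1) →
      σ ∈ diagramsNoOnes k ∧
        (∃ j, nontrivialCycles (value y W) + Multiset.replicate j 1 = removeColumn σ) ∧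
          (letters fun i => (W i).1).card + 1 + len σ ≤ k := by
    intro n W
    by_cases h1 : ∃ g, IsValue y W g
    · by_cases h2 : ∃ σ ∈ diagramsNoOnes k, FitsDiagram σ fun i => (W i).1
      · exact ⟨h2.choose, fun _ h => absurd h2 h⟩
      · obtain ⟨σ, h⟩ := exists_diagram_of_not_fits h1 h2
        exact ⟨σ, fun _ _ => h⟩
    · exact ⟨Nat.Partition.indiscrete k, fun h => absurd h h1⟩
  choose dg hdg using hdg
  let bad : (n : ℕ) → Finset (Fin k → Fin n × T) := fun n => (validWords n k y).filter fun W =>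
    ¬ ∃ σ ∈ diagramsNoOnes k, FitsDiagram σ fun i => (W i).1
  have hbad : ∀ n, ∀ W ∈ bad n, dg n W ∈ diagramsNoOnes k ∧
      (∃ j, nontrivialCycles (value y W) + Multiset.replicate j 1 = removeColumn (dg n W)) ∧
        (letters fun i => (W i).1).card + 1 + len (dg n W) ≤ k := by
    intro n W hW
    obtain ⟨h1, h2⟩ := Finset.mem_filter.1 hW
    exact hdg n W (Finset.mem_filter.1 h1).2 h2
  -- With this `ε`, the factor `n ^ (k - l) * (1 + ε)` is the exact number of injective choices of
  -- letters, and `N σ` collects the values of the non-fitting words attributed to `σ`.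
  refine ⟨fun σ n => (n.descFactorial (k - len σ) : ℝ) / (n : ℝ) ^ (k - len σ) - 1,
    fun σ n => ((bad n).filter fun W => dg n W = σ).val.map (value y), ?_, ?_, ?_⟩
  · exact fun σ _ => descFactorial_div_pow_sub_one_isBigO _
  · intro σ _
    constructor
    · intro n g hg
      obtain ⟨W, hW, rfl⟩ := Multiset.mem_map.1 hg
      obtain ⟨hW', rfl⟩ := Finset.mem_filter.1 hW
      exact (hbad n W hW').2.1
    -- If `l(σ) ≥ k`, the exponent is negative, but then no word is attributed to `σ`, as the number
    -- of its letters would be at most `k - l(σ) - 1`.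
    · by_cases hk : len σ + 1 ≤ k
      · obtain ⟨D, hD⟩ := Nat.exists_eq_add_of_le hk
        have hexp : (k : ℤ) - (len σ : ℤ) - 1 = (D : ℤ) := by omega
        refine IsBigO.of_bound ((D : ℝ) ^ k * (Fintype.card T : ℝ) ^ k) ?_
        filter_upwards [eventually_ge_atTop D] with n hn
        rw [hexp, zpow_natCast, Multiset.card_map, Real.norm_of_nonneg (Nat.cast_nonneg _),
          Real.norm_of_nonneg (by positivity)]
        have h1 : ((bad n).filter fun W => dg n W = σ).card ≤ n ^ D * D ^ k * Fintype.card T ^ k := by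
          refine (Finset.card_le_card fun W hW => ?_).trans (card_few_letters_labelled hn)
          obtain ⟨hW', rfl⟩ := Finset.mem_filter.1 hW
          have := (hbad n W hW').2.2
          exact Finset.mem_filter.2 ⟨Finset.mem_univ _, by omega⟩
        calc (((bad n).filter fun W => dg n W = σ).card : ℝ)
            ≤ ((n ^ D * D ^ k * Fintype.card T ^ k : ℕ) : ℝ) := by exact_mod_cast h1
          _ = (D : ℝ) ^ k * (Fintype.card T : ℝ) ^ k * (n : ℝ) ^ D := by push_cast; ring
      · have hempty : ∀ n, (bad n).filter (fun W => dg n W = σ) = ∅ := by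
          intro n
          refine Finset.filter_eq_empty_iff.2 fun W hW e => ?_
          have := (hbad n W hW).2.2
          rw [e] at this
          omega
        simp only [hempty, Finset.empty_val, Multiset.map_zero, Multiset.card_zero, Nat.cast_zero]
        exact isBigO_zero _ _
  -- The identity is exact for every `n ≥ 1`; the bound serves only to cancel the power of `n` in
  -- `ε`.
  · filter_upwards [eventually_ge_atTop 1] with n hn
    have hn0 : (n : ℂ) ≠ 0 := by exact_mod_cast (by omega : n ≠ 0)
    rw [restrictE_jm, ← Finset.sum_filter_add_sum_filter_not _
      fun W => ∃ σ ∈ diagramsNoOnes k, FitsDiagram σ fun i => (W i).1, Finset.sum_add_distrib]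
    congr 1
    · rw [sum_eq_sum_of_existsUnique _ (diagramsNoOnes k)
        (fun σ W => FitsDiagram σ fun i => (W i).1)]
      · refine Finset.sum_congr rfl fun σ hσ => ?_
        have hfilter : ((validWords n k y).filter fun W =>
            ∃ σ ∈ diagramsNoOnes k, FitsDiagram σ fun i => (W i).1).filter
              (fun W => FitsDiagram σ fun i => (W i).1) =
            (validWords n k y).filter fun W => FitsDiagram σ fun i => (W i).1 := by
          rw [Finset.filter_filter]
          exact Finset.filter_congr fun W _ => ⟨fun h => h.2, fun h => ⟨⟨σ, hσ, h⟩, h⟩⟩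
        rw [hfilter, sum_fitsDiagram hσ]
        refine Finset.sum_congr rfl fun ρ hρ => ?_
        rw [card_mainWords hσ hρ]
        congr 1
        push_cast
        field_simp
        ring
      · intro W hW
        obtain ⟨-, σ, hσ, h⟩ := Finset.mem_filter.1 hW
        exact ⟨σ, ⟨hσ, h⟩, fun σ' h' => h'.2.unique h'.1 hσ h⟩
    · rw [← Finset.sum_fiberwise_of_maps_to (s := bad n) (g := dg n)
        (fun W hW => (hbad n W hW).1)]
      refine Finset.sum_congr rfl fun σ _ => ?_
      rw [Multiset.map_map]
      rfl
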